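/- Fix an integer $m\ge 3$. **Trees.** Consider plane trees whose leaves (vertices of degree $1$) are each declared *opening* or *closing*, and which are rooted at an opening leaf (the root leaf); the other vertices are called nodes. The node adjacent to the root leaf, if any, is the root node; the tree with a single edge joining two leaves is called nodeless. An *$m$-bipartite tree* is such a tree with equally many opening and closing leaves, whose nodes all have degree $m$ and are coloured black or white so that adjacent nodes have different colours, whose root node is white (if the tree is not nodeless), whose opening leaves are adjacent to white nodes and whose closing leaves are adjacent to black nodes (if the tree is not nodeless), and in which every white node has exactly one black child, its other $m-2$ children being opening leaves. List the leaves in the order of a clockwise walk around the tree starting with the root leaf. The *height* of a closing leaf $c$ is the number of opening leaves before $c$ (root leaf included) minus the number of closing leaves before $c$. The tree is *balanced* if all these heights are positive. An *enriched $m$-bipartite tree* is a balanced $m$-bipartite tree together with an integer $\iota(c)\in\{0,\dots,h-1\}$ for each closing leaf $c$ of height $h$. A *forward matching* of an $m$-bipartite tree is a perfect matching between its opening leaves (root leaf included) and its closing leaves such that in each pair the opening leaf comes before the closing leaf. **Maps.** A *rooted $m$-regular bipartite map* is a connected map on an orientable closed surface of arbitrary genus, up to orientation-preserving homeomorphism,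 whose vertices all have degree $m$ and are coloured black or white so that adjacent vertices have different colours, with a marked corner at a white vertex. By convention the family of these maps is completed by one trivial map, which has no vertex. **Series.** There are formal power series $r_i(g),q_i(g)$, $i\ge 1$, with integer coefficients, uniquely determined by $$r_i(g)=i+\sum_{a=0}^{m-2}q_{i-a}(g),\qquad q_i(g)=g\prod_{a=0}^{m-2}r_{i+a}(g)\qquad(i\ge 1),$$ where $q_i=0$ for $i\le 0$; in particular $r_1=1+q_1$. **Theorem.** The following three families are in bijection: 1. enriched $m$-bipartite trees, 2. $m$-bipartite trees endowed with a forward matching, 3. rooted $m$-regular bipartite maps (including the trivial one). The bijections can be chosen so that the one between 1 and 2 preserves the underlying tree (hence the number of black nodes) and the one between 2 and 3 sends the number of black nodes to the number of black vertices. For every $n\ge0$, each of the three families has finitely many elements with $n$ black nodes (resp. vertices), and their number is the coefficient of $g^n$ in $r_1(g)=1+q_1(g)$. Equivalently, for the third family, the number of rooted $m$-regular bipartite maps, without the trivial one, with $n$ black vertices is the coefficient of $g^n$ in $q_1(g)$. -/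

import Mathlib

namespace BlossomMaps

/-! ## Blossoming trees -/

/-- The two colours of nodes (of trees) and of vertices (of maps). -/
inductive Color
  | white
  | black
  deriving DecidableEq

/-- The two kinds of leaves of a blossoming tree. -/
inductive LeafKind
  | opening
  | closing
  deriving DecidableEq

/-- A plane tree with two-coloured nodes and two kinds of leaves, rooted at an opening leaf.
The root leaf is not recorded: a term of this type describes what hangs at the other end of the
edge that starts from the root leaf. So `leaf closing` is the nodeless tree (one edge joining the
opening root leaf to a closing leaf).
A node `node c k children` has the colour `c` and `k + 1` children, hence degree `k + 2 ≥ 2`; the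
children are listed in clockwise order around the node, starting just after the edge to the parent
(or to the root leaf), which is the order in which the clockwise walk around the tree meets them. -/
inductive PlantedTree : Type
  | leaf (kind : LeafKind) : PlantedTree
  | node (c : Color) (k : ℕ) (children : Fin (k + 1) → PlantedTree) : PlantedTree

namespace PlantedTree

/-- The kinds of the leaves other than the root leaf, in the order of the clockwise walk. -/
def nonrootLeaves : PlantedTree → List LeafKind
  | leaf kind => [kind]
  | node _ _ children => (List.ofFn fun j => nonrootLeaves (children j)).flatten

/-- The kinds of all leaves in the order of the clockwise walk, starting with the (opening)
root leaf, which has position `0`. -/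
def leaves (T : PlantedTree) : List LeafKind := LeafKind.opening :: T.nonrootLeaves

/-- The blossoming condition: as many opening as closing leaves (root leaf included). -/
def IsBlossoming (T : PlantedTree) : Prop :=
  T.leaves.count LeafKind.opening = T.leaves.count LeafKind.closing

/-- The number of black nodes. -/
def blackNodes : PlantedTree → ℕ
  | leaf _ => 0
  | node c _ children => (if c = Color.black then 1 else 0) + ∑ j, blackNodes (children j)

/-- The tree consists of more than a leaf and its top node has the colour `c`. -/
def IsNodeOfColor (c : Color) : PlantedTree → Prop
  | leaf _ => False
  | node c' _ _ => c' = c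

/-- The tree consists of a single leaf of the given kind. -/
def IsLeafOfKind (kind : LeafKind) : PlantedTree → Prop
  | leaf kind' => kind' = kind
  | node _ _ _ => False

/-- What may be a child of a node of the given colour: no two adjacent nodes have the same colour,
opening leaves are adjacent to white nodes, and closing leaves are adjacent to black nodes. -/
def AllowedChild : Color → PlantedTree → Prop
  | Color.white, T => T.IsNodeOfColor Color.black ∨ T.IsLeafOfKind LeafKind.opening
  | Color.black, T => T.IsNodeOfColor Color.white ∨ T.IsLeafOfKind LeafKind.closing

/-- Every node has degree `m` and only allowed children, and every white node has exactly one
black child (so its other `m - 2` children are opening leaves). -/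
def NodesOK (m : ℕ) : PlantedTree → Prop
  | leaf _ => True
  | node c k children =>
      k + 2 = m ∧
      (∀ j, AllowedChild c (children j)) ∧
      (c = Color.white → ∃! j, (children j).IsNodeOfColor Color.black) ∧
      ∀ j, NodesOK m (children j)

/-- `m`-bipartite trees: blossoming trees whose nodes satisfy the above conditions, and which
are nodeless or have a white root node. -/
structure IsMBipartite (m : ℕ) (T : PlantedTree) : Prop where
  blossoming : T.IsBlossoming
  nodesOK : T.NodesOK m
  root_white : T.IsNodeOfColor Color.white ∨ T = leaf LeafKind.closing

/-- The opening leaves (root leaf included), given by their positions in the clockwise walk. -/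
def OpeningLeaf (T : PlantedTree) : Type :=
  {j : Fin T.leaves.length // T.leaves.get j = LeafKind.opening}

/-- The closing leaves, given by their positions in the clockwise walk. -/
def ClosingLeaf (T : PlantedTree) : Type :=
  {j : Fin T.leaves.length // T.leaves.get j = LeafKind.closing}

/-- The height of a closing leaf: the height from which the corresponding down-step of the
leaf-path descends. The leaf-path starts at height `1`, after the root leaf (which is counted
among the opening leaves here), and goes up at opening leaves and down at closing leaves. -/
def height (T : PlantedTree) (c : T.ClosingLeaf) : ℤ :=
  ((T.leaves.take c.1).count LeafKind.opening : ℤ) - (T.leaves.take c.1).count LeafKind.closing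

/-- A tree is balanced if the height of every closing leaf is positive. -/
def IsBalanced (T : PlantedTree) : Prop := ∀ c : T.ClosingLeaf, 0 < T.height c

end PlantedTree

/-- An enriched `m`-bipartite tree: a balanced `m`-bipartite tree endowed with a
matching-assignment, that is, an integer in `[0 .. h - 1]` for each closing leaf of height `h`. -/
structure EnrichedTree (m : ℕ) where
  tree : PlantedTree
  isMBipartite : tree.IsMBipartite m
  isBalanced : tree.IsBalanced
  index : tree.ClosingLeaf → ℕ
  index_lt : ∀ c, (index c : ℤ) < tree.height c

/-- An `m`-bipartite tree endowed with a forward matching: a perfect matching of the closing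
leaves with the opening leaves (root leaf included) such that, in each pair, the opening leaf
appears before the closing leaf. -/
structure MatchedTree (m : ℕ) where
  tree : PlantedTree
  isMBipartite : tree.IsMBipartite m
  matching : tree.ClosingLeaf ≃ tree.OpeningLeaf
  forward : ∀ c, (matching c).1 < c.1

/-! ## Maps of arbitrary genus -/

/-- A rooted (connected) map on an oriented closed surface of arbitrary genus, with at least one
edge and with half-edges labelled by `Fin size`: `rot` sends a half-edge to the next one in
clockwise order around its vertex, `opp` sends it to the other half of its edge. The vertices are
the cycles of `rot`. The root corner is given by the half-edge that follows it in clockwise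
order. -/
structure LabelledRootedMap where
  size : ℕ
  rot : Equiv.Perm (Fin size)
  opp : Equiv.Perm (Fin size)
  opp_opp : ∀ h, opp (opp h) = h
  opp_ne : ∀ h, opp h ≠ h
  connected : ∀ h h', ∃ g ∈ Subgroup.closure {rot, opp}, g h = h'
  root : Fin size

/-- A rooted `m`-regular bipartite map (with labelled half-edges): every vertex has degree `m`, the
vertices are coloured so that the two ends of each edge have different colours, and the root
corner is at a white vertex. The colour of a vertex is recorded on its half-edges. -/
structure LabelledMap (m : ℕ) extends LabelledRootedMap where
  color : Fin size → Color
  color_rot : ∀ h, color (rot h) = color h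
  color_opp : ∀ h, color (opp h) ≠ color h
  color_root : color root = Color.white
  regular : ∀ h, {h' | rot.SameCycle h h'}.ncard = m

namespace LabelledMap

variable {m : ℕ}

/-- `φ` is an isomorphism of rooted bipartite maps. -/
structure IsIso (M M' : LabelledMap m) (φ : Fin M.size ≃ Fin M'.size) : Prop where
  map_rot : ∀ h, φ (M.rot h) = M'.rot (φ h)
  map_opp : ∀ h, φ (M.opp h) = M'.opp (φ h)
  map_root : φ M.root = M'.root
  map_color : ∀ h, M'.color (φ h) = M.color h

/-- Maps are considered up to relabelling of the half-edges. -/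
instance setoid (m : ℕ) : Setoid (LabelledMap m) where
  r M M' := ∃ φ, IsIso M M' φ
  iseqv :=
    { refl := fun M => ⟨Equiv.refl _, ⟨fun _ => rfl, fun _ => rfl, rfl, fun _ => rfl⟩⟩
      symm := by
        rintro M M' ⟨φ, hφ⟩
        refine ⟨φ.symm, ⟨fun h => ?_, fun h => ?_, ?_, fun h => ?_⟩⟩
        · rw [Equiv.symm_apply_eq, hφ.map_rot, Equiv.apply_symm_apply]
        · rw [Equiv.symm_apply_eq, hφ.map_opp, Equiv.apply_symm_apply]
        · rw [Equiv.symm_apply_eq, hφ.map_root]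
        · rw [← hφ.map_color, Equiv.apply_symm_apply]
      trans := by
        rintro M M' M'' ⟨φ, hφ⟩ ⟨ψ, hψ⟩
        refine ⟨φ.trans ψ, ⟨fun h => ?_, fun h => ?_, ?_, fun h => ?_⟩⟩
        · simp [hφ.map_rot, hψ.map_rot]
        · simp [hφ.map_opp, hψ.map_opp]
        · simp [hφ.map_root, hψ.map_root]
        · simp [hφ.map_color, hψ.map_color] }

/-- The vertices of a map: the cycles of `rot`. -/
def Vertex (M : LabelledMap m) : Type := Quotient (Equiv.Perm.SameCycle.setoid M.rot)

/-- The number of black vertices of a map. -/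
noncomputable def blackVertices (M : LabelledMap m) : ℕ :=
  Nat.card {v : M.Vertex // ∃ h, M.color h = Color.black ∧ Quotient.mk _ h = v}

theorem sameCycle_iff {M M' : LabelledMap m} {φ : Fin M.size ≃ Fin M'.size} (hφ : IsIso M M' φ)
    (a b : Fin M.size) : M.rot.SameCycle a b ↔ M'.rot.SameCycle (φ a) (φ b) := by
  have key : M'.rot = φ.permCongr M.rot := by
    ext h
    rw [Equiv.permCongr_apply, hφ.map_rot, Equiv.apply_symm_apply]
  have hz : ∀ (i : ℤ) (x : Fin M.size), (M'.rot ^ i) (φ x) = φ ((M.rot ^ i) x) := by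
    intro i x
    have h2 : (φ.permCongr M.rot) ^ i = φ.permCongr (M.rot ^ i) :=
      (map_zpow (φ.permCongrHom) M.rot i).symm
    rw [key, h2, Equiv.permCongr_apply, Equiv.symm_apply_apply]
  unfold Equiv.Perm.SameCycle
  simp only [hz, EmbeddingLike.apply_eq_iff_eq]

theorem blackVertices_congr {M M' : LabelledMap m} (h : M ≈ M') :
    M.blackVertices = M'.blackVertices := by
  obtain ⟨φ, hφ⟩ := h
  let e : M.Vertex ≃ M'.Vertex := Quotient.congr φ (fun a b => sameCycle_iff hφ a b)
  refine Nat.card_congr (e.subtypeEquiv fun v => ?_)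
  constructor
  · rintro ⟨d, hd, rfl⟩
    exact ⟨φ d, by rw [hφ.map_color, hd], rfl⟩
  · rintro ⟨d, hd, hv⟩
    refine ⟨φ.symm d, by rw [← hφ.map_color, Equiv.apply_symm_apply, hd], ?_⟩
    apply e.injective
    rw [← hv]
    change (Quotient.mk _ (φ (φ.symm d)) : M'.Vertex) = _
    rw [Equiv.apply_symm_apply]

end LabelledMap

/-- Rooted `m`-regular bipartite maps of unfixed genus (with at least one edge), up to
isomorphism. -/
def RootedMap (m : ℕ) : Type := Quotient (LabelledMap.setoid m)

/-- The number of black vertices of a rooted `m`-regular bipartite map. -/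
noncomputable def RootedMap.blackVertices {m : ℕ} (M : RootedMap m) : ℕ :=
  Quotient.lift LabelledMap.blackVertices (fun _ _ h => LabelledMap.blackVertices_congr h) M

/-- The family of rooted `m`-regular bipartite maps, completed with the trivial map `none`, which
has no vertex and is counted by the constant term `1` of `r₁`. -/
abbrev RootedMapOrTrivial (m : ℕ) : Type := Option (RootedMap m)

/-- The number of black vertices, which is `0` for the trivial map. -/
noncomputable def RootedMapOrTrivial.blackVertices {m : ℕ} : RootedMapOrTrivial m → ℕ
  | none => 0
  | some M => M.blackVertices

/-! ## The recursive system -/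

/-- The families `r_i`, `q_i` of formal power series (in the variable `g`) solve the system
`r_i = i + ∑_{a=0}^{m-2} q_{i-a}`, `q_i = g ∏_{a=0}^{m-2} r_{i+a}` for `i ≥ 1`, where `q_i = 0` for
`i ≤ 0`. The values `r_i` for `i ≤ 0` play no role. -/
structure IsSolution (m : ℕ) (r q : ℤ → PowerSeries ℤ) : Prop where
  q_nonpos : ∀ i ≤ 0, q i = 0
  r_eq : ∀ i ≥ 1, r i = (i : PowerSeries ℤ) + ∑ a ∈ Finset.range (m - 1), q (i - a)
  q_eq : ∀ i ≥ 1, q i = PowerSeries.X * ∏ a ∈ Finset.range (m - 1), r (i + a)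

end BlossomMaps

namespace BlossomMaps

/-! ## The recursive system over a general coefficient ring -/

/-! For a fixed tree, matching-assignments and forward matchings are both counted by the product of
the heights of the closing leaves (`PlantedTree.card_assignment`, `card_forwardMatching`), which
gives the first bijection, tree by tree. The second is only asserted to respect the number of black
nodes, so it follows from equal finite counts in each degree (`exists_equiv_of_card_fiber`). It
remains to show that trees and maps are both counted by `r_1`.

Trees. Merging each white node with its black child leaves a position `a` and `k + 1 = m - 1`
subtrees, each lowering the leaf-path by one. Weighting trees by the product of heights, for
leaf-paths starting at height `i`, gives series that solve the system (`WhiteTree.series_eq`).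

Maps. Let `d = m - 1` and let `B` be the bilinear form on polynomials whose moments count possibly
disconnected bipartite maps with legs, with a variable `t` per vertex. Deleting a leg shows that the
adjoint of multiplication by `X` is `D + t X ^ d` (`moment_succ`). Hence the monic orthogonal
polynomials satisfy `X P_n = P_(n+1) + c_n P_(n-d)` (`OrthogonalFamily.X_mul`), and the ratios `h_i
/ h_(i-1)` of their norms solve the system with `g = t ^ 2` (`OrthogonalFamily.solvesSystem`).
Solutions are unique X-adically, so `r_1 = h_1 / h_0`. With `Z` the series of all maps, `h_0 = Z`
and `h_1 = Z + m g Z'`; thus `q_1 = m g Z' / Z`.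

Finally, a map is a pair of permutations of its edges with all cycles of length `m`. Sorting pairs
with a marked edge by the component of that edge yields `R Z = m g Z'` for the series `R` of rooted
connected maps (`mapCount_mul_allMaps`); rooted maps have no automorphisms, so passing from labelled
to unlabelled objects divides by `(m n)!`. Hence `q_1 = R`. -/

/-- The system `r_i = i + ∑_{a<d} q_{i-a}`, `q_i = c ∏_{a<d} r_{i+a}` for `i ≥ 1`, with `q_i = 0` for
`i ≤ 0`. -/
structure SolvesSystem {R : Type*} [CommRing R] (d : ℕ) (c : R) (r q : ℤ → R) : Prop where
  q_nonpos : ∀ i ≤ 0, q i = 0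
  r_eq : ∀ i ≥ 1, r i = (i : R) + ∑ a ∈ Finset.range d, q (i - a)
  q_eq : ∀ i ≥ 1, q i = c * ∏ a ∈ Finset.range d, r (i + a)

theorem isSolution_iff {m : ℕ} {r q : ℤ → PowerSeries ℤ} :
    IsSolution m r q ↔ SolvesSystem (m - 1) PowerSeries.X r q :=
  ⟨fun h => ⟨h.1, h.2, h.3⟩, fun h => ⟨h.1, h.2, h.3⟩⟩

theorem SolvesSystem.map {R S : Type*} [CommRing R] [CommRing S] (f : R →+* S) {d : ℕ} {c : R}
    {r q : ℤ → R} (h : SolvesSystem d c r q) :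
    SolvesSystem d (f c) (fun i => f (r i)) (fun i => f (q i)) where
  q_nonpos i hi := by simp [h.q_nonpos i hi]
  r_eq i hi := by simp [h.r_eq i hi]
  q_eq i hi := by simp [h.q_eq i hi]

/-- The system is contracting: the factor `c` gains one power of `X` when passing from the `r`'s to
the `q`'s, and none is lost on the way back. A general `c` allows both `g` and `t ^ 2`. -/
theorem SolvesSystem.pow_dvd {A : Type*} [CommRing A] {d : ℕ} {c : PowerSeries A}
    (hc : PowerSeries.X ∣ c) {r q r' q' : ℤ → PowerSeries A} (h : SolvesSystem d c r q)
    (h' : SolvesSystem d c r' q') (n : ℕ) :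
    (∀ i ≥ 1, PowerSeries.X ^ n ∣ r i - r' i) ∧ ∀ i, PowerSeries.X ^ n ∣ q i - q' i := by
  induction n with
  | zero => simp
  | succ n ih =>
    have hq : ∀ i, PowerSeries.X ^ (n + 1) ∣ q i - q' i := by
      intro i
      rcases le_or_gt i 0 with hi | hi
      · simp [h.q_nonpos i hi, h'.q_nonpos i hi]
      · rw [h.q_eq i hi, h'.q_eq i hi, ← mul_sub, pow_succ']
        refine mul_dvd_mul hc ?_
        -- In the quotient by `X ^ n` the congruence of products is factorwise equality.
        rw [← Ideal.mem_span_singleton, ← Ideal.Quotient.eq, map_prod, map_prod]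
        refine Finset.prod_congr rfl fun a _ => ?_
        rw [Ideal.Quotient.eq, Ideal.mem_span_singleton]
        exact ih.1 _ (by omega)
    refine ⟨fun i hi => ?_, hq⟩
    rw [h.r_eq i hi, h'.r_eq i hi, add_sub_add_left_eq_sub, ← Finset.sum_sub_distrib]
    exact Finset.dvd_sum fun a _ => hq _

theorem PowerSeries.eq_of_forall_X_pow_dvd {A : Type*} [CommRing A] {f g : PowerSeries A}
    (h : ∀ n, PowerSeries.X ^ n ∣ f - g) : f = g := by
  ext n
  have := PowerSeries.X_pow_dvd_iff.mp (h (n + 1)) n (Nat.lt_succ_self n)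
  rwa [map_sub, sub_eq_zero] at this

theorem SolvesSystem.unique {A : Type*} [CommRing A] {d : ℕ} {c : PowerSeries A}
    (hc : PowerSeries.X ∣ c) {r q r' q' : ℤ → PowerSeries A} (h : SolvesSystem d c r q)
    (h' : SolvesSystem d c r' q') (i : ℤ) (hi : i ≥ 1) : r i = r' i ∧ q i = q' i :=
  ⟨PowerSeries.eq_of_forall_X_pow_dvd fun n => (h.pow_dvd hc h' n).1 i hi,
    PowerSeries.eq_of_forall_X_pow_dvd fun n => (h.pow_dvd hc h' n).2 i⟩

/-! ## Orthogonal polynomials -/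

section Orthogonal

open Polynomial

/-- `P` is a family of monic orthogonal polynomials for the symmetric form `B` for which the adjoint
of the multiplication by `X` is `D + t X ^ d`, and which pairs nontrivially only monomials with
congruent exponents modulo `d + 1`. -/
structure OrthogonalFamily {R : Type*} [CommRing R] (d : ℕ) (t : R)
    (B : R[X] →ₗ[R] R[X] →ₗ[R] R) (P : ℕ → R[X]) (k : ℕ → R) : Prop where
  symm : ∀ p q, B p q = B q p
  adj : ∀ p q, B (X * p) q = B p (derivative q + C t * (X ^ d * q))
  monic : ∀ n, (P n).coeff n = 1
  degree_le : ∀ n, (P n).natDegree ≤ n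
  orth : ∀ i j, i ≠ j → B (P i) (P j) = 0
  shift : ∀ i j, ¬ i + 1 ≡ j [MOD d + 1] → B (X * P i) (P j) = 0
  inv : ∀ n, B (P n) (P n) * k n = 1

namespace OrthogonalFamily

variable {R : Type*} [CommRing R] {d : ℕ} {t : R}
  {B : R[X] →ₗ[R] R[X] →ₗ[R] R} {P : ℕ → R[X]} {k : ℕ → R}

theorem degree_sub_lt (H : OrthogonalFamily d t B P k) {n : ℕ} {p : R[X]} (hp : p.degree < (n + 1 : ℕ)) :
    (p - p.coeff n • P n).degree < n := by
  rw [degree_lt_iff_coeff_zero] at hp ⊢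
  intro j hj
  rcases hj.eq_or_lt with rfl | hj
  · simp [H.monic]
  · have : (P n).coeff j = 0 := coeff_eq_zero_of_natDegree_lt ((H.degree_le n).trans_lt hj)
    simp [hp j hj, this]

/-- The `P j` with `j < l` span the polynomials of degree below `l`; the induction on `l`, with `n`
fixed, strips off leading terms. -/
theorem eq_zero_of_degree_lt (H : OrthogonalFamily d t B P k) {n : ℕ} :
    ∀ {l : ℕ} (_ : l ≤ n) {p : R[X]} (_ : p.degree < l), B p (P n) = 0 := by
  intro l
  induction l with
  | zero =>
    intro _ p hp
    have : p = 0 := by simpa using hp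
    simp [this]
  | succ l ih =>
    intro hl p hp
    have h1 := ih (by omega) (H.degree_sub_lt hp)
    rw [map_sub, map_smul, LinearMap.sub_apply, LinearMap.smul_apply, H.orth l n (by omega)] at h1
    simpa using h1

theorem apply_eq_coeff (H : OrthogonalFamily d t B P k) {n : ℕ} {p : R[X]}
    (hp : p.degree < (n + 1 : ℕ)) : B p (P n) = p.coeff n * B (P n) (P n) := by
  have h1 := H.eq_zero_of_degree_lt le_rfl (H.degree_sub_lt hp)
  rw [map_sub, map_smul, LinearMap.sub_apply, LinearMap.smul_apply, sub_eq_zero] at h1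
  simpa using h1

/-- Nondegeneracy: pairing with `P n` for `n` the top degree recovers the leading coefficient,
because the norms are invertible. -/
theorem eq_zero (H : OrthogonalFamily d t B P k) {p : R[X]} (hp : ∀ n, B p (P n) = 0) : p = 0 := by
  have key : ∀ n : ℕ, p.degree < n → p = 0 := by
    intro n
    induction n with
    | zero => intro h; simpa using h
    | succ n ih =>
      intro h
      have h1 := H.apply_eq_coeff h
      rw [hp n] at h1
      have h2 : p.coeff n = 0 := by
        have := H.inv n
        calc p.coeff n = p.coeff n * B (P n) (P n) * k n := by rw [mul_assoc, this, mul_one]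
          _ = 0 := by rw [← h1, zero_mul]
      have h3 := H.degree_sub_lt h
      rw [h2, zero_smul, sub_zero] at h3
      exact ih h3
  exact key (p.natDegree + 1) (degree_le_natDegree.trans_lt (by exact_mod_cast Nat.lt_succ_self _))

theorem degree_lt_of_coeff {p : R[X]} {n : ℕ} (h : ∀ j, n ≤ j → p.coeff j = 0) : p.degree < n :=
  (degree_lt_iff_coeff_zero _ _).mpr h

theorem coeff_P (H : OrthogonalFamily d t B P k) {n j : ℕ} (h : n < j) : (P n).coeff j = 0 :=
  coeff_eq_zero_of_natDegree_lt ((H.degree_le n).trans_lt h)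

/-- The coefficient of `P (n - d)` in `X * P n`. -/
noncomputable def down (d : ℕ) (t : R) (B : R[X] →ₗ[R] R[X] →ₗ[R] R) (P : ℕ → R[X]) (k : ℕ → R) (n : ℕ) : R :=
  if d ≤ n then t * B (P n) (P n) * k (n - d) else 0

/-- Both sides are paired with each `P j`. Above `n + 1` degrees give zero, and at `n + 1` both are
monic. For `j ≤ n` the residue condition leaves only `j ≤ n - d`; there the adjoint turns `P j` into
a polynomial of degree at most `j + d`, so only `j = n - d` survives. For `n < d` the truncated
index is harmless since `down` vanishes. -/
theorem X_mul (H : OrthogonalFamily d t B P k) (n : ℕ) :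
    X * P n = P (n + 1) + down d t B P k n • P (n - d) := by
  rw [← sub_eq_zero]
  refine H.eq_zero fun j => ?_
  simp only [map_sub, map_add, map_smul, LinearMap.sub_apply, LinearMap.add_apply,
    LinearMap.smul_apply, smul_eq_mul]
  rcases lt_trichotomy j (n + 1) with hj | rfl | hj
  · rw [H.orth (n + 1) j (by omega), zero_add]
    by_cases hmod : n + 1 ≡ j [MOD d + 1]
    -- Distinct indices in the same class modulo `d + 1` differ by at least `d + 1`.
    · have hjd : j + d ≤ n := by
        obtain ⟨c, hc⟩ := (Nat.modEq_iff_dvd' hj.le).mp hmod.symm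
        rcases c with _ | c
        · omega
        · rw [Nat.mul_succ] at hc; omega
      rw [H.adj, H.symm]
      have hdeg : (derivative (P j) + C t * (X ^ d * P j)).degree < ((n + 1 : ℕ) : WithBot ℕ) := by
        apply degree_lt_of_coeff
        intro l hl
        rw [coeff_add, coeff_derivative, coeff_C_mul, coeff_X_pow_mul', if_pos (by omega),
          H.coeff_P (by omega), H.coeff_P (by omega)]
        ring
      rw [H.apply_eq_coeff hdeg, coeff_add, coeff_derivative, coeff_C_mul, coeff_X_pow_mul',
        if_pos (by omega), H.coeff_P (by omega : j < n + 1), down, if_pos (by omega)]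
      rcases hjd.eq_or_lt with h | h
      · have h1 : n - d = j := by omega
        rw [h1, H.monic]
        linear_combination (-t * B (P n) (P n)) * H.inv j
      · rw [H.coeff_P (by omega), H.orth (n - d) j (by omega)]
        ring
    · rw [H.shift n j hmod]
      unfold down
      split_ifs with hd
      · rw [H.orth (n - d) j]
        · ring
        · rintro rfl
          apply hmod
          have : n + 1 = (n - d) + (d + 1) := by omega
          rw [this]
          exact Nat.add_modEq_right
      · ring
  · rw [H.apply_eq_coeff, coeff_X_mul, H.monic, H.orth (n - d) (n + 1) (by omega)]
    · ring
    · apply degree_lt_of_coeff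
      intro l hl
      obtain ⟨l, rfl⟩ := Nat.exists_eq_add_of_lt (show 0 < l by omega)
      rw [zero_add, coeff_X_mul, H.coeff_P (by omega)]
  · rw [H.orth (n + 1) j (by omega), H.orth (n - d) j (by omega), H.eq_zero_of_degree_lt le_rfl]
    · ring
    · apply degree_lt_of_coeff
      intro l hl
      obtain ⟨l, rfl⟩ := Nat.exists_eq_add_of_lt (show 0 < l by omega)
      rw [zero_add, coeff_X_mul, H.coeff_P (by omega)]

/-- Expanding by `X_mul` gives paths of `e` steps, each `+1` or `-d`. The relation between the
endpoints forces exactly one down-step, and `a` is the number of up-steps before it. -/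
theorem X_pow_mul_apply (H : OrthogonalFamily d t B P k) (e : ℕ) : ∀ (i n : ℕ), e ≤ d →
    i + d + 1 = n + e →
    B (X ^ e * P n) (P i) = (∑ a ∈ Finset.range e, down d t B P k (n + a)) * B (P i) (P i) := by
  induction e with
  | zero => intro i n _ h; simpa using H.orth n i (by omega)
  | succ e ih =>
    intro i n he h
    rw [pow_succ, mul_assoc, H.X_mul, mul_add, mul_smul_comm, map_add, map_smul,
      LinearMap.add_apply, LinearMap.smul_apply, ih i (n + 1) (by omega) (by omega),
      Finset.sum_range_succ']
    -- The down-step comes first here; the remaining `X ^ e` lifts `P (n - d)` to degree `i`, so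
    -- only its leading coefficient matters.
    have : down d t B P k n • B (X ^ e * P (n - d)) (P i)
        = down d t B P k n * B (P i) (P i) := by
      by_cases hd : d ≤ n
      · rw [H.apply_eq_coeff, coeff_X_pow_mul', if_pos (by omega),
          show i - e = n - d by omega, H.monic, one_mul, smul_eq_mul]
        apply degree_lt_of_coeff
        intro l hl
        rw [coeff_X_pow_mul', if_pos (by omega), H.coeff_P (by omega)]
      · simp [down, hd]
    rw [this, add_mul, add_zero]
    simp only [add_assoc, add_comm 1]

/-- Two evaluations of `B (X * P j) (P (j + 1))`: by leading coefficients, and by the adjoint, whose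
derivative part contributes `j + 1` and whose `t X ^ d` part the sum over down-steps. -/
theorem norm_succ (H : OrthogonalFamily d t B P k) (j : ℕ) :
    B (P (j + 1)) (P (j + 1)) = (((j + 1 : ℕ) : R) +
      t * ∑ a ∈ Finset.range d, down d t B P k (j + 1 + a)) * B (P j) (P j) := by
  have h1 : B (X * P j) (P (j + 1)) = B (P (j + 1)) (P (j + 1)) := by
    rw [H.apply_eq_coeff, coeff_X_mul, H.monic, one_mul]
    apply degree_lt_of_coeff
    intro l hl
    obtain ⟨l, rfl⟩ := Nat.exists_eq_add_of_lt (show 0 < l by omega)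
    rw [zero_add, coeff_X_mul, H.coeff_P (by omega)]
  rw [← h1, H.adj, H.symm, map_add, LinearMap.add_apply, ← smul_eq_C_mul, map_smul,
    LinearMap.smul_apply, H.X_pow_mul_apply d j (j + 1) le_rfl (by omega), H.apply_eq_coeff,
    coeff_derivative, H.monic, smul_eq_mul]
  · push_cast; ring
  · apply degree_lt_of_coeff
    intro l hl
    rw [coeff_derivative, H.coeff_P (by omega), zero_mul]

theorem prod_ratio (H : OrthogonalFamily d t B P k) (i l : ℕ) :
    ∏ a ∈ Finset.range l, (B (P (i + 1 + a)) (P (i + 1 + a)) * k (i + a))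
      = B (P (i + l)) (P (i + l)) * k i := by
  induction l with
  | zero => simp [H.inv]
  | succ l ih =>
    rw [Finset.prod_range_succ, ih, show i + 1 + l = i + (l + 1) by ring]
    linear_combination (B (P (i + (l + 1))) (P (i + (l + 1))) * k i) * H.inv (i + l)

/-- With `h_n` the norms, `r_i = h_i / h_(i-1)` and `q_i = t c_(i+d-1) = t ^ 2 h_(i+d-1) / h_(i-1)`.
The equation for `q` is a telescoping product, the one for `r` is `norm_succ` with the sum reversed.
-/
theorem solvesSystem (H : OrthogonalFamily d t B P k) (hd : 1 ≤ d) :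
    SolvesSystem d (t ^ 2)
      (fun i => B (P i.toNat) (P i.toNat) * k (i.toNat - 1))
      (fun i => if i ≤ 0 then 0 else t * down d t B P k (i.toNat + d - 1)) where
  q_nonpos i hi := if_pos hi
  r_eq i hi := by
    obtain ⟨j, rfl⟩ : ∃ j : ℕ, i = (j + 1 : ℕ) := ⟨(i - 1).toNat, by omega⟩
    simp only [Int.toNat_natCast]
    rw [H.norm_succ, Nat.add_sub_cancel, mul_assoc, H.inv, mul_one, Int.cast_natCast,
      Finset.mul_sum, ← Finset.sum_range_reflect]
    congr 1
    refine Finset.sum_congr rfl fun a ha => ?_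
    rw [Finset.mem_range] at ha
    -- Terms with `i - a ≤ 0` correspond to `down` at an index below `d`, which is zero too.
    split_ifs with h
    · rw [down, if_neg (by omega), mul_zero]
    · congr 2
      omega
  q_eq i hi := by
    obtain ⟨j, rfl⟩ : ∃ j : ℕ, i = (j + 1 : ℕ) := ⟨(i - 1).toNat, by omega⟩
    rw [if_neg (by omega)]
    have := H.prod_ratio j d
    have h2 : ∀ a : ℕ, (((j + 1 : ℕ) : ℤ) + a).toNat = j + 1 + a := by intro a; omega
    simp only [h2, show ∀ a, j + 1 + a - 1 = j + a by intro a; omega]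
    rw [this, down, if_pos (by omega), Int.toNat_natCast, show j + 1 + d - 1 = j + d by omega,
      Nat.add_sub_cancel]
    ring

end OrthogonalFamily

end Orthogonal

end BlossomMaps

namespace BlossomMaps

/-! ### The bilinear form of bipartite maps with legs, and its orthogonal polynomials. -/

section BipartiteForm

open Polynomial

/-- The moments of the form: the coefficient of `t ^ N` sums the weights of the pairs of sets of
`p.1` white and `p.2` black vertices of degree `m`, with `a` and `b` additional legs. -/
noncomputable def moment (m a b : ℕ) : PowerSeries ℚ :=
  PowerSeries.mk fun N => ∑ p ∈ Finset.HasAntidiagonal.antidiagonal N, if a + m * p.1 = b + m * p.2 then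
    ((a + m * p.1).factorial : ℚ) / (m ^ N * p.1.factorial * p.2.factorial) else 0

theorem moment_comm (m a b : ℕ) : moment m a b = moment m b a := by
  ext N
  simp only [moment, PowerSeries.coeff_mk]
  rw [← Finset.Nat.sum_antidiagonal_swap]
  refine Finset.sum_congr rfl ?_
  rintro ⟨x, y⟩ _
  simp only [Prod.swap_prod_mk]
  by_cases h : b + m * x = a + m * y
  · rw [if_pos h, if_pos h.symm, h, mul_right_comm]
  · rw [if_neg h, if_neg (Ne.symm h)]

theorem moment_eq_zero {m a b : ℕ} (h : ¬ a ≡ b [MOD m]) : moment m a b = 0 := by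
  ext N
  simp only [moment, PowerSeries.coeff_mk, map_zero]
  refine Finset.sum_eq_zero fun p _ => if_neg fun hp => h ?_
  have h1 : a + m * p.1 ≡ a [MOD m] := by simp [Nat.ModEq]
  have h2 : b + m * p.2 ≡ b [MOD m] := by simp [Nat.ModEq]
  exact h1.symm.trans (hp ▸ h2)

/-- Deletion of one white leg: it is joined either to one of the `b` black legs or to a half-edge of
a black vertex, whose other `d` half-edges become legs. In formulas, `M ! = (b + m y) (M - 1)!` for
`M = b + m y`, split at the sum. -/
theorem moment_succ (d a b : ℕ) :
    moment (d + 1) (a + 1) b =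
      (b : PowerSeries ℚ) * moment (d + 1) a (b - 1)
        + PowerSeries.X * moment (d + 1) a (b + d) := by
  ext N
  have hm : ((d + 1 : ℕ) : ℚ) ≠ 0 := by positivity
  rw [map_add, ← map_natCast (PowerSeries.C (R := ℚ)), PowerSeries.coeff_C_mul]
  have key : ∀ x y : ℕ, a + 1 + (d + 1) * x = b + (d + 1) * y →
      ((a + 1 + (d + 1) * x).factorial : ℚ) =
        (b + (d + 1 : ℕ) * y) * (a + (d + 1) * x).factorial := by
    intro x y h
    rw [show a + 1 + (d + 1) * x = a + (d + 1) * x + 1 by ring, Nat.factorial_succ,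
      show a + (d + 1) * x + 1 = b + (d + 1) * y by omega]
    push_cast
    ring
  -- The factor `b` makes the truncated `b - 1` harmless at `b = 0`.
  have hfirst : ∀ x y : ℕ, (b : ℚ) * (if a + (d + 1) * x = b - 1 + (d + 1) * y then
      ((a + (d + 1) * x).factorial : ℚ) / ((d + 1 : ℕ) ^ N * x.factorial * y.factorial) else 0) =
      if a + 1 + (d + 1) * x = b + (d + 1) * y then
      (b : ℚ) * (a + (d + 1) * x).factorial / ((d + 1 : ℕ) ^ N * x.factorial * y.factorial)
      else 0 := by
    intro x y
    rcases Nat.eq_zero_or_pos b with rfl | hb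
    · simp
    · rw [mul_ite, mul_zero, mul_div_assoc]
      refine if_congr ?_ rfl rfl
      constructor <;> intro h <;> omega
  cases N with
  | zero =>
    have h := hfirst 0 0
    simp only [moment, PowerSeries.coeff_mk, Finset.Nat.antidiagonal_zero, Finset.sum_singleton,
      PowerSeries.coeff_zero_X_mul, add_zero]
    rw [h]
    refine if_ctx_congr Iff.rfl (fun hh => ?_) fun _ => rfl
    have := key 0 0 hh
    rw [this]
    simp
  | succ N =>
    rw [PowerSeries.coeff_succ_X_mul]
    simp only [moment, PowerSeries.coeff_mk]
    rw [Finset.mul_sum]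
    simp only [hfirst]
    -- The terms without black vertices are split off: there a leg can only meet a leg.
    rw [Finset.Nat.sum_antidiagonal_succ', Finset.Nat.sum_antidiagonal_succ' (n := N)]
    conv_rhs => rw [add_assoc, ← Finset.sum_add_distrib, add_comm]
    rw [add_comm]
    congr 1
    · refine Finset.sum_congr rfl fun p _ => ?_
      by_cases h : a + 1 + (d + 1) * p.1 = b + (d + 1) * (p.2 + 1)
      · rw [if_pos h, if_pos h, if_pos (by rw [Nat.mul_succ] at h; omega), key _ _ h,
          Nat.factorial_succ, pow_succ]
        have h1 : (p.1.factorial : ℚ) ≠ 0 := by positivity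
        have h2 : (p.2.factorial : ℚ) ≠ 0 := by positivity
        have h3 : ((p.2 : ℚ) + 1) ≠ 0 := by positivity
        have h4 : (d : ℚ) + 1 ≠ 0 := by positivity
        push_cast
        field_simp
      · rw [if_neg h, if_neg h, if_neg (by rw [Nat.mul_succ] at h; omega), add_zero]
    · refine if_ctx_congr Iff.rfl (fun hh => ?_) fun _ => rfl
      rw [key _ _ hh]
      simp

/-- The bilinear form with the given moments. -/
noncomputable def momentForm (m : ℕ) :
    (PowerSeries ℚ)[X] →ₗ[PowerSeries ℚ] (PowerSeries ℚ)[X] →ₗ[PowerSeries ℚ] PowerSeries ℚ :=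
  (basisMonomials _).constr (PowerSeries ℚ) fun a =>
    (basisMonomials _).constr (PowerSeries ℚ) fun b => moment m a b

theorem momentForm_X_pow (m a b : ℕ) : momentForm m (X ^ a) (X ^ b) = moment m a b := by
  have h : ∀ n : ℕ, (X ^ n : (PowerSeries ℚ)[X]) = basisMonomials _ n := by
    intro n; simp [X_pow_eq_monomial]
  rw [h, h, momentForm, Module.Basis.constr_basis, Module.Basis.constr_basis]

theorem momentForm_apply (m : ℕ) (p q : (PowerSeries ℚ)[X]) :
    momentForm m p q = ∑ a ∈ p.support, ∑ b ∈ q.support, p.coeff a * (q.coeff b * moment m a b) := by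
  conv_lhs => rw [p.as_sum_support_C_mul_X_pow, q.as_sum_support_C_mul_X_pow]
  simp only [map_sum, LinearMap.sum_apply, ← smul_eq_C_mul, map_smul, LinearMap.smul_apply,
    momentForm_X_pow, smul_eq_mul, Finset.mul_sum]
  rw [Finset.sum_comm]
  refine Finset.sum_congr rfl fun a _ => Finset.sum_congr rfl fun b _ => by ring

theorem momentForm_symm (m : ℕ) (p q : (PowerSeries ℚ)[X]) :
    momentForm m p q = momentForm m q p := by
  rw [momentForm_apply, momentForm_apply, Finset.sum_comm]
  refine Finset.sum_congr rfl fun a _ => Finset.sum_congr rfl fun b _ => ?_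
  rw [moment_comm]; ring

theorem momentForm_adj (d : ℕ) (p q : (PowerSeries ℚ)[X]) :
    momentForm (d + 1) (X * p) q =
      momentForm (d + 1) p (derivative q + C PowerSeries.X * (X ^ d * q)) := by
  induction p using Polynomial.induction_on' with
  | add p₁ p₂ h₁ h₂ => 
    rw [mul_add, map_add, LinearMap.add_apply, h₁, h₂, ← LinearMap.add_apply, ← map_add]
  | monomial a c =>
    rw [← C_mul_X_pow_eq_monomial, ← smul_eq_C_mul, mul_smul_comm, map_smul, map_smul,
      LinearMap.smul_apply, LinearMap.smul_apply]
    congr 1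
    induction q using Polynomial.induction_on' with
    | add q₁ q₂ h₁ h₂ =>
      rw [map_add, h₁, h₂, derivative_add, ← map_add]
      congr 1
      ring
    | monomial b c =>
      rw [← C_mul_X_pow_eq_monomial, derivative_C_mul, derivative_X_pow, ← mul_assoc (X ^ d),
        mul_comm (X ^ d) (C c), mul_assoc (C c), ← pow_add, ← pow_succ', ← smul_eq_C_mul,
        ← smul_eq_C_mul, ← smul_eq_C_mul, ← smul_eq_C_mul, ← smul_eq_C_mul, map_smul,
        smul_comm PowerSeries.X c, ← smul_add,
        map_smul, map_add, map_smul, map_smul, momentForm_X_pow, momentForm_X_pow,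
        momentForm_X_pow, moment_succ, add_comm d b, smul_eq_mul, smul_eq_mul, smul_eq_mul, smul_eq_mul]

/-- All exponents of `p` are congruent to `c` modulo `m`. -/
def SupportedMod (m c : ℕ) (p : (PowerSeries ℚ)[X]) : Prop := ∀ a, p.coeff a ≠ 0 → a ≡ c [MOD m]

theorem momentForm_eq_zero {m i j : ℕ} {p q : (PowerSeries ℚ)[X]} (hp : SupportedMod m i p)
    (hq : SupportedMod m j q) (h : ¬ i ≡ j [MOD m]) : momentForm m p q = 0 := by
  rw [momentForm_apply]
  refine Finset.sum_eq_zero fun a ha => Finset.sum_eq_zero fun b hb => ?_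
  rw [moment_eq_zero, mul_zero, mul_zero]
  intro hab
  exact h ((hp a (mem_support_iff.mp ha)).symm.trans (hab.trans (hq b (mem_support_iff.mp hb))))

theorem supportedMod_X_pow (m n : ℕ) : SupportedMod m n (X ^ n) := by
  intro a ha
  rw [coeff_X_pow] at ha
  split_ifs at ha with h
  · rw [h]
  · exact absurd rfl ha

/-- The Gram-Schmidt orthogonalisation of the monomials. -/
noncomputable def orthPoly (m : ℕ) : ℕ → (PowerSeries ℚ)[X]
  | n => X ^ n - ∑ j : Fin n, (momentForm m (X ^ n) (orthPoly m j) *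
      (momentForm m (orthPoly m j) (orthPoly m j))⁻¹) • orthPoly m j
  decreasing_by all_goals exact j.2

theorem orthPoly_eq (m n : ℕ) : orthPoly m n = X ^ n - ∑ j ∈ Finset.range n,
    (momentForm m (X ^ n) (orthPoly m j) *
      (momentForm m (orthPoly m j) (orthPoly m j))⁻¹) • orthPoly m j := by
  rw [orthPoly, Finset.sum_range]

theorem orthPoly_natDegree_le (m n : ℕ) : (orthPoly m n).natDegree ≤ n := by
  induction n using Nat.strong_induction_on with
  | _ n ih =>
    rw [orthPoly_eq]
    refine (natDegree_sub_le_of_le (natDegree_X_pow_le n)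
      (natDegree_sum_le_of_forall_le (n := n) _ _ fun j hj => ?_)).trans_eq (max_self n)
    rw [Finset.mem_range] at hj
    exact (natDegree_smul_le _ _).trans ((ih j hj).trans hj.le)

theorem orthPoly_coeff_self (m n : ℕ) : (orthPoly m n).coeff n = 1 := by
  rw [orthPoly_eq, coeff_sub, coeff_X_pow_self, finsetSum_coeff, Finset.sum_eq_zero, sub_zero]
  intro j hj
  rw [Finset.mem_range] at hj
  rw [coeff_smul, coeff_eq_zero_of_natDegree_lt ((orthPoly_natDegree_le m j).trans_lt hj), smul_zero]

/-- Gram-Schmidt subtracts from `X ^ n` only polynomials of the same residue class, the others being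
already orthogonal to it. -/
theorem orthPoly_supportedMod (m n : ℕ) : SupportedMod m n (orthPoly m n) := by
  induction n using Nat.strong_induction_on with
  | _ n ih =>
    intro a ha
    by_contra hmod
    apply ha
    rw [orthPoly_eq, coeff_sub, finsetSum_coeff, coeff_X_pow, if_neg (by rintro rfl; exact hmod rfl),
      zero_sub, neg_eq_zero]
    refine Finset.sum_eq_zero fun j hj => ?_
    rw [Finset.mem_range] at hj
    rw [coeff_smul]
    by_cases h : n ≡ j [MOD m]
    · have : (orthPoly m j).coeff a = 0 := by
        by_contra h0
        exact hmod ((ih j hj a h0).trans h.symm)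
      rw [this, smul_zero]
    · rw [momentForm_eq_zero (supportedMod_X_pow m n) (ih j hj) h, zero_mul, zero_smul]

/-- Without vertices, legs are matched with legs: at `t = 0` the form is diagonal with entries `a
!`, which is the source of invertibility of the norms. -/
theorem constantCoeff_moment (m a b : ℕ) :
    PowerSeries.constantCoeff (moment m a b) = if a = b then (a.factorial : ℚ) else 0 := by
  rw [← PowerSeries.coeff_zero_eq_constantCoeff_apply, moment, PowerSeries.coeff_mk]
  simp

theorem constantCoeff_momentForm (m a : ℕ) (q : (PowerSeries ℚ)[X]) :
    PowerSeries.constantCoeff (momentForm m (X ^ a) q) =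
      a.factorial * PowerSeries.constantCoeff (q.coeff a) := by
  induction q using Polynomial.induction_on' with
  | add q₁ q₂ h₁ h₂ => rw [map_add, map_add, h₁, h₂, coeff_add, map_add, mul_add]
  | monomial b c =>
    rw [← C_mul_X_pow_eq_monomial, ← smul_eq_C_mul, map_smul, momentForm_X_pow, smul_eq_mul,
      map_mul, constantCoeff_moment, coeff_smul, coeff_X_pow, smul_eq_mul, map_mul]
    split_ifs <;> simp [mul_comm]

/-- Both claims go through one induction: orthogonality at `n` needs the inverses of the earlier
norms to be genuine, and orthogonality reduces the norm at `n` to a pairing with `X ^ n`, of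
constant term `n !`. -/
theorem orthPoly_orth_inv (m n : ℕ) :
    (∀ j < n, momentForm m (orthPoly m n) (orthPoly m j) = 0) ∧
    momentForm m (orthPoly m n) (orthPoly m n) *
      (momentForm m (orthPoly m n) (orthPoly m n))⁻¹ = 1 := by
  induction n using Nat.strong_induction_on with
  | _ n ih =>
    have h1 : ∀ j < n, momentForm m (orthPoly m n) (orthPoly m j) = 0 := by
      intro j hj
      rw [orthPoly_eq m n, map_sub, LinearMap.sub_apply, map_sum, LinearMap.sum_apply,
        Finset.sum_eq_single j]
      · rw [map_smul, LinearMap.smul_apply, smul_eq_mul, mul_assoc, mul_comm _⁻¹, (ih j hj).2,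
          mul_one, sub_self]
      · intro l hl hne
        rw [Finset.mem_range] at hl
        rw [map_smul, LinearMap.smul_apply]
        rcases lt_or_gt_of_ne hne with h | h
        · rw [momentForm_symm m (orthPoly m l) (orthPoly m j), (ih j hj).1 l h, smul_zero]
        · rw [(ih l hl).1 j h, smul_zero]
      · intro h
        exact absurd (Finset.mem_range.mpr hj) h
    refine ⟨h1, PowerSeries.mul_inv_cancel _ ?_⟩
    have h2 : momentForm m (orthPoly m n) (orthPoly m n) = momentForm m (X ^ n) (orthPoly m n) := by
      conv_lhs => rw [momentForm_symm]
      conv_lhs => enter [2]; rw [orthPoly_eq m n]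
      rw [map_sub, map_sum, Finset.sum_eq_zero, sub_zero, momentForm_symm]
      intro j hj
      rw [map_smul, h1 j (Finset.mem_range.mp hj), smul_zero]
    rw [h2, constantCoeff_momentForm, orthPoly_coeff_self, map_one, mul_one]
    positivity

theorem orthogonalFamily_orthPoly (d : ℕ) : OrthogonalFamily d PowerSeries.X (momentForm (d + 1))
    (orthPoly (d + 1))
    (fun n => (momentForm (d + 1) (orthPoly (d + 1) n) (orthPoly (d + 1) n))⁻¹) where
  symm := momentForm_symm _
  adj := momentForm_adj d
  monic := orthPoly_coeff_self _
  degree_le := orthPoly_natDegree_le _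
  orth i j h := by
    rcases lt_or_gt_of_ne h with h | h
    · rw [momentForm_symm, (orthPoly_orth_inv _ j).1 i h]
    · exact (orthPoly_orth_inv _ i).1 j h
  shift i j h := by
    refine momentForm_eq_zero (i := i + 1) (j := j) ?_ (orthPoly_supportedMod _ j) h
    intro a ha
    rcases a with _ | a
    · simp at ha
    · rw [coeff_X_mul] at ha
      exact (orthPoly_supportedMod _ i a ha).add_right 1
  inv n := (orthPoly_orth_inv _ n).2

theorem orthPoly_zero (m : ℕ) : orthPoly m 0 = 1 := by
  rw [orthPoly_eq, Finset.sum_range_zero, pow_zero, sub_zero]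

theorem orthPoly_one {m : ℕ} (hm : 2 ≤ m) : orthPoly m 1 = X := by
  rw [orthPoly_eq, Finset.sum_range_one, orthPoly_zero,
    show (1 : (PowerSeries ℚ)[X]) = X ^ 0 by simp, momentForm_X_pow, moment_eq_zero]
  · simp
  · intro h
    have := (Nat.modEq_iff_dvd' (Nat.zero_le 1)).mp h.symm
    have := Nat.le_of_dvd one_pos this
    omega

end BipartiteForm

/-! ### The series `r_1` in terms of the series of all maps. -/

/-- The generating function of all (possibly disconnected) `m`-regular bipartite maps. -/
noncomputable def allMaps (m : ℕ) : PowerSeries ℚ :=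
  PowerSeries.mk fun n => ((m * n).factorial : ℚ) / (m ^ (2 * n) * n.factorial ^ 2)

/-- Equally many legs of both colours force equally many vertices of both colours, so only even
powers of `t` occur and the moment is a series in `g = t ^ 2`. -/
theorem moment_self {m : ℕ} (hm : 0 < m) (a : ℕ) : moment m a a = PowerSeries.expand 2 two_ne_zero
    (PowerSeries.mk fun n => ((a + m * n).factorial : ℚ) / (m ^ (2 * n) * n.factorial ^ 2)) := by
  ext N
  rw [PowerSeries.coeff_expand, moment, PowerSeries.coeff_mk]
  have hiff : ∀ p : ℕ × ℕ, a + m * p.1 = a + m * p.2 ↔ p.1 = p.2 := by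
    intro p
    rw [Nat.add_left_cancel_iff, Nat.mul_left_cancel_iff hm]
  simp only [hiff]
  split_ifs with h
  · obtain ⟨n, rfl⟩ := h
    rw [Finset.sum_eq_single (n, n), if_pos rfl, PowerSeries.coeff_mk,
      Nat.mul_div_cancel_left _ two_pos, pow_two (n.factorial : ℚ), mul_assoc]
    · rintro ⟨x, y⟩ hp hne
      rw [Finset.HasAntidiagonal.mem_antidiagonal] at hp
      refine if_neg fun (hxy : x = y) => hne ?_
      simp only at hp
      rw [Prod.mk.injEq]; omega
    · intro hn
      exact absurd (Finset.HasAntidiagonal.mem_antidiagonal.mpr (two_mul n).symm) hn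
  · refine Finset.sum_eq_zero ?_
    rintro ⟨x, y⟩ hp
    rw [Finset.HasAntidiagonal.mem_antidiagonal] at hp
    refine if_neg fun (hxy : x = y) => h ?_
    simp only at hp
    exact ⟨x, by omega⟩

/-- After the substitution `g = t ^ 2`, uniqueness identifies `r 1` with the ratio of the norms of
`X` and `1`. These are diagonal moments, and the factorial `(m n + 1)!` in the first yields the
factor `m n + 1`. -/
theorem SolvesSystem.mul_allMaps {d : ℕ} (hd : 1 ≤ d) {r q : ℤ → PowerSeries ℚ}
    (h : SolvesSystem d PowerSeries.X r q) :
    r 1 * allMaps (d + 1) = PowerSeries.mk fun n =>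
      (((d + 1 : ℕ) : ℚ) * n + 1) * PowerSeries.coeff n (allMaps (d + 1)) := by
  have H := orthogonalFamily_orthPoly d
  have h1 := h.map (PowerSeries.expand 2 two_ne_zero : PowerSeries ℚ →ₐ[ℚ] _).toRingHom
  have h2 := H.solvesSystem hd
  have hX : (PowerSeries.expand 2 two_ne_zero : PowerSeries ℚ →ₐ[ℚ] _).toRingHom PowerSeries.X
      = PowerSeries.X ^ 2 := PowerSeries.expand_X 2 two_ne_zero
  rw [hX] at h1
  have h3 := (h1.unique (Dvd.intro_left _ (pow_succ _ 1).symm) h2 1 le_rfl).1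
  have h4 := H.inv 0
  have hz : momentForm (d + 1) (orthPoly (d + 1) 0) (orthPoly (d + 1) 0)
      = PowerSeries.expand 2 two_ne_zero (allMaps (d + 1)) := by
    rw [orthPoly_zero, show (1 : Polynomial (PowerSeries ℚ)) = Polynomial.X ^ 0 by simp,
      momentForm_X_pow, moment_self (Nat.succ_pos d), allMaps]
    simp only [zero_add]
  have ho : momentForm (d + 1) (orthPoly (d + 1) 1) (orthPoly (d + 1) 1)
      = PowerSeries.expand 2 two_ne_zero (PowerSeries.mk fun n =>
      (((d + 1 : ℕ) : ℚ) * n + 1) * PowerSeries.coeff n (allMaps (d + 1))) := by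
    rw [orthPoly_one (by omega), show (Polynomial.X : Polynomial (PowerSeries ℚ))
      = Polynomial.X ^ 1 by simp, momentForm_X_pow, moment_self (Nat.succ_pos d)]
    congr 2
    ext n
    rw [allMaps, PowerSeries.coeff_mk, add_comm 1, Nat.factorial_succ]
    push_cast
    ring
  have hinj : Function.Injective (PowerSeries.expand (R := ℚ) 2 two_ne_zero) := by
    intro f g hfg
    ext n
    rw [← PowerSeries.coeff_expand_mul 2 two_ne_zero, hfg, PowerSeries.coeff_expand_mul]
  apply hinj
  rw [map_mul, ← hz, ← ho]
  have h5 : PowerSeries.expand 2 two_ne_zero (r 1) = momentForm (d + 1) (orthPoly (d + 1) 1)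
      (orthPoly (d + 1) 1) * (momentForm (d + 1) (orthPoly (d + 1) 0) (orthPoly (d + 1) 0))⁻¹ := h3
  rw [h5, mul_assoc, mul_comm _⁻¹, h4, mul_one]

end BlossomMaps

namespace BlossomMaps

/-! ## Trees as a recursive family -/

/-- The shape of an `m`-bipartite tree, `m = k + 2`: a node stands for a white node together with
its black child, which is at position `a` among the children of the white node. -/
inductive WhiteTree (k : ℕ) : Type
  | leaf : WhiteTree k
  | node (a : Fin (k + 1)) (children : Fin (k + 1) → WhiteTree k) : WhiteTree k

namespace WhiteTree

variable {k : ℕ}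

/-- The number of black nodes. -/
def size : WhiteTree k → ℕ
  | leaf => 0
  | node _ ch => 1 + ∑ j, size (ch j)

/-- The number of matching-assignments of the tree when its leaf-path starts at the given
height. -/
def weight : WhiteTree k → ℤ → ℕ
  | leaf, i => i.toNat
  | node a ch, i => ∏ j : Fin (k + 1), weight (ch j) (i + a.1 - j.1)

theorem weight_of_nonpos (T : WhiteTree k) : ∀ i ≤ 0, T.weight i = 0 := by
  induction T with
  | leaf => intro i hi; exact Int.toNat_of_nonpos hi
  | node a ch ih =>
    intro i hi
    -- The last subtree starts at height `i + a - k ≤ i`, so its weight already vanishes.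
    refine Finset.prod_eq_zero (Finset.mem_univ (Fin.last k)) (ih _ _ ?_)
    have := a.2
    rw [Fin.val_last]
    omega

theorem finite_size_le (n : ℕ) : {T : WhiteTree k | T.size ≤ n}.Finite := by
  induction n with
  | zero =>
    refine (Set.finite_singleton leaf).subset fun T hT => ?_
    cases T with
    | leaf => rfl
    | node a ch => simp [size] at hT
  | succ n ih =>
    have h1 : (⋃ a : Fin (k + 1), node a ''
        (Set.pi Set.univ fun _ => {T : WhiteTree k | T.size ≤ n})).Finite :=
      Set.finite_iUnion fun a => (Set.Finite.pi' fun _ => ih).image _ |>.subset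
        (Set.image_mono fun f hf j => hf j (Set.mem_univ j))
    refine ((Set.finite_singleton leaf).union h1).subset fun T hT => ?_
    cases T with
    | leaf => exact Or.inl rfl
    | node a ch =>
      refine Or.inr (Set.mem_iUnion.mpr ⟨a, ch, fun j _ => ?_, rfl⟩)
      have h2 : (ch j).size ≤ ∑ j, (ch j).size :=
        Finset.single_le_sum (f := fun j => (ch j).size) (fun _ _ => Nat.zero_le _)
          (Finset.mem_univ j)
      have h3 : 1 + ∑ j, (ch j).size ≤ n + 1 := hT
      simp only [Set.mem_ofPred_eq]
      omega

variable (k) in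
theorem finite_size_eq (n : ℕ) : {T : WhiteTree k | T.size = n}.Finite :=
  (finite_size_le n).subset fun _ hT => le_of_eq hT

variable (k) in
/-- The trees of a given size. -/
noncomputable def ofSize (n : ℕ) : Finset (WhiteTree k) := (finite_size_eq k n).toFinset

@[simp] theorem mem_ofSize {n : ℕ} {T : WhiteTree k} : T ∈ ofSize k n ↔ T.size = n := by
  simp [ofSize]

open Classical in
variable (k) in
/-- The tuples of trees of given total size. -/
noncomputable def forests (n : ℕ) : Finset (Fin (k + 1) → WhiteTree k) :=
  (Finset.finsuppAntidiag Finset.univ n).biUnion fun l => Fintype.piFinset fun j => ofSize k (l j)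

theorem mem_forests {n : ℕ} {ch : Fin (k + 1) → WhiteTree k} :
    ch ∈ forests k n ↔ ∑ j, (ch j).size = n := by
  simp only [forests, Finset.mem_biUnion, Finset.mem_finsuppAntidiag, Fintype.mem_piFinset,
    mem_ofSize]
  constructor
  · rintro ⟨l, ⟨h1, -⟩, h2⟩
    rw [← h1]
    exact Finset.sum_congr rfl fun j _ => h2 j
  · intro h
    exact ⟨Finsupp.equivFunOnFinite.symm fun j => (ch j).size, ⟨h, Finset.subset_univ _⟩,
      fun _ => rfl⟩

variable (k) in
/-- The generating function of the trees weighted by their matching-assignments. -/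
noncomputable def series (i : ℤ) : PowerSeries ℤ :=
  PowerSeries.mk fun n => ∑ T ∈ ofSize k n, (T.weight i : ℤ)

theorem coeff_prod_series (f : Fin (k + 1) → ℤ) (n : ℕ) :
    PowerSeries.coeff n (∏ j, series k (f j)) =
      ∑ ch ∈ forests k n, ∏ j, ((ch j).weight (f j) : ℤ) := by
  classical
  rw [PowerSeries.coeff_prod, forests, Finset.sum_biUnion]
  · refine Finset.sum_congr (by congr) fun l _ => ?_
    simp only [series, PowerSeries.coeff_mk]
    rw [Finset.prod_univ_sum]
  · intro l _ l' _ hne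
    rw [Function.onFun, Finset.disjoint_left]
    intro ch h h'
    rw [Fintype.mem_piFinset] at h h'
    apply hne
    ext j
    rw [← mem_ofSize.mp (h j), ← mem_ofSize.mp (h' j)]

theorem sum_ofSize_succ (n : ℕ) (w : WhiteTree k → ℤ) :
    ∑ T ∈ ofSize k (n + 1), w T = ∑ a, ∑ ch ∈ forests k n, w (node a ch) := by
  classical
  rw [← Finset.sum_product']
  symm
  refine Finset.sum_bij (fun p _ => node p.1 p.2) ?_ ?_ ?_ ?_
  · rintro ⟨a, ch⟩ h
    rw [Finset.mem_product, mem_forests] at h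
    rw [mem_ofSize, size, h.2, add_comm]
  · rintro ⟨a, ch⟩ _ ⟨a', ch'⟩ _ h
    injection h with h1 h2
    exact Prod.ext h1 h2
  · intro T hT
    rw [mem_ofSize] at hT
    cases T with
    | leaf => simp [size] at hT
    | node a ch =>
      refine ⟨(a, ch), ?_, rfl⟩
      rw [Finset.mem_product, mem_forests]
      refine ⟨Finset.mem_univ _, ?_⟩
      simp only [size] at hT
      change ∑ j, (ch j).size = n
      omega
  · intros; rfl

theorem ofSize_zero : ofSize k 0 = {leaf} := by
  ext T
  rw [mem_ofSize, Finset.mem_singleton]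
  cases T <;> simp [size]

variable (k) in
/-- The generating function of the subtrees hanging from a white node, in terms of the final height
of their leaf-path, augmented by one. -/
noncomputable def blackSeries (i : ℤ) : PowerSeries ℤ :=
  PowerSeries.X * ∏ a ∈ Finset.range (k + 1), series k (i + a)

theorem series_of_nonpos {i : ℤ} (hi : i ≤ 0) : series k i = 0 := by
  ext n
  simp [series, weight_of_nonpos _ i hi]

/-- The sum runs over the position of the black child. At position `a` its leaf-path starts at `i +
a` and its subtrees start at `i + a - j`; in terms of the final height this is `blackSeries` at `i -
(k - a)`, whence the reversal of the sum. -/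
theorem series_eq (i : ℤ) :
    series k i = (i.toNat : PowerSeries ℤ) + ∑ a ∈ Finset.range (k + 1), blackSeries k (i - a) := by
  have hb : ∀ i : ℤ, blackSeries k i =
      PowerSeries.X * ∏ j : Fin (k + 1), series k (i + k - j.1) := by
    intro i
    rw [blackSeries, ← Finset.prod_range_reflect, Finset.prod_range]
    congr 1
    refine Finset.prod_congr rfl fun j _ => congrArg _ ?_
    have := j.2
    omega
  rw [← Finset.sum_range_reflect, Finset.sum_range]
  ext n
  rw [map_add, map_sum, ← map_natCast (PowerSeries.C (R := ℤ)), PowerSeries.coeff_C]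
  simp only [hb]
  cases n with
  | zero =>
    simp only [PowerSeries.coeff_zero_X_mul, Finset.sum_const_zero, add_zero, if_true]
    rw [series, PowerSeries.coeff_mk, ofSize_zero, Finset.sum_singleton]
    rfl
  | succ n =>
    simp only [PowerSeries.coeff_succ_X_mul, coeff_prod_series]
    rw [if_neg (Nat.succ_ne_zero n), zero_add, series, PowerSeries.coeff_mk, sum_ofSize_succ]
    refine Finset.sum_congr rfl fun a _ => Finset.sum_congr rfl fun ch _ => ?_
    rw [weight, Nat.cast_prod]
    refine Finset.prod_congr rfl fun j _ => ?_
    have := a.2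
    congr 2
    omega

variable (k) in
theorem solvesSystem_series :
    SolvesSystem (k + 1) PowerSeries.X (series k) (blackSeries k) where
  q_nonpos i hi := by
    rw [blackSeries, Finset.prod_eq_zero (Finset.mem_range.mpr (Nat.succ_pos k)), mul_zero]
    rw [Nat.cast_zero, add_zero, series_of_nonpos hi]
  r_eq i hi := by
    rw [series_eq]
    congr 1
    obtain ⟨j, rfl⟩ := Int.eq_ofNat_of_zero_le (zero_le_one.trans hi)
    simp
  q_eq i _ := rfl

/-! ### Leaf words -/

end WhiteTree

/-- The number of opening leaves minus the number of closing leaves. -/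
def excess (L : List LeafKind) : ℤ := L.count LeafKind.opening - L.count LeafKind.closing

/-- The product of the heights of the closing leaves of a leaf-path that starts at the given
height. -/
def wordWeight : ℤ → List LeafKind → ℕ
  | _, [] => 1
  | i, LeafKind.opening :: L => wordWeight (i + 1) L
  | i, LeafKind.closing :: L => i.toNat * wordWeight (i - 1) L

theorem excess_opening_cons (L : List LeafKind) : excess (LeafKind.opening :: L) = 1 + excess L := by
  simp [excess]; ring

theorem excess_closing_cons (L : List LeafKind) : excess (LeafKind.closing :: L) = -1 + excess L := by
  simp [excess]; ring

theorem excess_append (L L' : List LeafKind) : excess (L ++ L') = excess L + excess L' := by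
  simp [excess]; ring

theorem wordWeight_append (L L' : List LeafKind) : ∀ i : ℤ,
    wordWeight i (L ++ L') = wordWeight i L * wordWeight (i + excess L) L' := by
  induction L with
  | nil => intro i; simp [wordWeight, excess]
  | cons x L ih =>
    intro i
    cases x
    · rw [List.cons_append, wordWeight, wordWeight, ih, excess_opening_cons, add_assoc]
    · rw [List.cons_append, wordWeight, wordWeight, ih, excess_closing_cons, mul_assoc, ← add_assoc,
        ← sub_eq_add_neg]

theorem excess_flatten_ofFn {n : ℕ} (f : Fin n → List LeafKind) :
    excess (List.ofFn f).flatten = ∑ j, excess (f j) := by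
  induction n with
  | zero => simp [excess]
  | succ n ih => rw [List.ofFn_succ, List.flatten_cons, excess_append, ih, Fin.sum_univ_succ]

theorem wordWeight_flatten_descending {n : ℕ} (f : Fin n → List LeafKind)
    (hf : ∀ j, excess (f j) = -1) : ∀ i : ℤ,
    wordWeight i (List.ofFn f).flatten = ∏ j : Fin n, wordWeight (i - j.1) (f j) := by
  induction n with
  | zero => intro i; simp [wordWeight]
  | succ n ih =>
    intro i
    rw [List.ofFn_succ, List.flatten_cons, wordWeight_append, ih _ fun j => hf _,
      Fin.prod_univ_succ, hf]
    congr 1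
    · simp
    · refine Finset.prod_congr rfl fun j _ => congrArg₂ _ ?_ rfl
      rw [Fin.val_succ]; push_cast; ring

theorem wordWeight_flatten_openings (n : ℕ) : ∀ i : ℤ,
    wordWeight i (List.ofFn fun _ : Fin n => [LeafKind.opening]).flatten = 1 := by
  induction n with
  | zero => intro i; simp [wordWeight]
  | succ n ih => intro i; rw [List.ofFn_succ, List.flatten_cons]; exact ih (i + 1)

theorem wordWeight_flatten_single {n : ℕ} (a : Fin n) (L : List LeafKind) : ∀ i : ℤ,
    wordWeight i (List.ofFn fun j => if j = a then L else [LeafKind.opening]).flatten =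
      wordWeight (i + a.1) L := by
  induction n with
  | zero => exact a.elim0
  | succ n ih =>
    intro i
    rw [List.ofFn_succ, List.flatten_cons]
    refine Fin.cases ?_ (fun a => ?_) a
    · simp only [if_true, Fin.succ_ne_zero, if_false]
      rw [wordWeight_append, wordWeight_flatten_openings, mul_one]
      simp
    · simp only [(Fin.succ_ne_zero a).symm, if_false, Fin.succ_inj]
      refine (ih a (i + 1)).trans (congrArg₂ _ ?_ rfl)
      rw [Fin.val_succ]; push_cast; ring

/-! ### Shapes and their planted trees. -/

namespace WhiteTree

variable {k : ℕ}

/-- The planted tree of the given shape. -/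
def toTree : WhiteTree k → PlantedTree
  | leaf => PlantedTree.leaf LeafKind.closing
  | node a ch => PlantedTree.node Color.white k fun j =>
      if j = a then PlantedTree.node Color.black k fun l => toTree (ch l)
      else PlantedTree.leaf LeafKind.opening

theorem nonrootLeaves_node (a : Fin (k + 1)) (ch : Fin (k + 1) → WhiteTree k) :
    (node a ch).toTree.nonrootLeaves = (List.ofFn fun j => if j = a then
      (List.ofFn fun l => (ch l).toTree.nonrootLeaves).flatten else [LeafKind.opening]).flatten := by
  rw [toTree, PlantedTree.nonrootLeaves]
  congr 2
  funext j
  split_ifs <;> rfl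

/-- At a node, `k` opening leaves compensate all but one of the `k + 1` descents. -/
theorem excess_toTree (T : WhiteTree k) : excess T.toTree.nonrootLeaves = -1 := by
  induction T with
  | leaf => rfl
  | node a ch ih =>
    have h1 : excess (List.ofFn fun l => (ch l).toTree.nonrootLeaves).flatten = -(k + 1 : ℤ) := by
      rw [excess_flatten_ofFn]
      simp [ih]
    rw [nonrootLeaves_node, excess_flatten_ofFn, ← Finset.add_sum_erase _ _ (Finset.mem_univ a),
      if_pos rfl, h1, Finset.sum_congr rfl (g := fun _ => (1 : ℤ))]
    · simp
    · intro j hj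
      rw [if_neg (Finset.ne_of_mem_erase hj)]
      rfl

/-- The `a` opening leaves before the black child raise the path to `i + a`, each earlier subtree
lowers it by one, and the opening leaves after the black child do not matter. -/
theorem wordWeight_toTree (T : WhiteTree k) : ∀ i : ℤ,
    wordWeight i T.toTree.nonrootLeaves = T.weight i := by
  induction T with
  | leaf => intro i; exact mul_one _
  | node a ch ih =>
    intro i
    rw [nonrootLeaves_node, wordWeight_flatten_single, wordWeight_flatten_descending _
      fun j => excess_toTree _, weight]
    exact Finset.prod_congr rfl fun j _ => ih j _

theorem blackNodes_toTree (T : WhiteTree k) : T.toTree.blackNodes = T.size := by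
  induction T with
  | leaf => rfl
  | node a ch ih =>
    rw [toTree, PlantedTree.blackNodes, if_neg (by simp), zero_add,
      ← Finset.add_sum_erase _ _ (Finset.mem_univ a), if_pos rfl, PlantedTree.blackNodes,
      if_pos rfl, size, Finset.sum_eq_zero (s := Finset.univ.erase a), add_zero]
    · simp [ih]
    · intro j hj
      rw [if_neg (Finset.ne_of_mem_erase hj)]
      rfl

theorem toTree_injective : Function.Injective (toTree : WhiteTree k → PlantedTree) := by
  intro T
  induction T with
  | leaf => intro T' h; cases T' with
    | leaf => rfl
    | node a ch => simp [toTree] at h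
  | node a ch ih =>
    intro T' h
    cases T' with
    | leaf => simp [toTree] at h
    | node a' ch' =>
      rw [toTree, toTree] at h
      injection h with _ _ h
      have ha : a = a' := by
        by_contra hne
        have := congrFun h a
        simp [hne] at this
      subst ha
      have h2 := congrFun h a
      simp only [if_true] at h2
      injection h2 with _ _ h2
      congr 1
      funext l
      exact ih l (congrFun h2 l)

theorem root_toTree (T : WhiteTree k) :
    T.toTree.IsNodeOfColor Color.white ∨ T.toTree.IsLeafOfKind LeafKind.closing := by
  cases T with
  | leaf => exact Or.inr rfl
  | node a ch => exact Or.inl rfl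

theorem nodesOK_toTree (T : WhiteTree k) : T.toTree.NodesOK (k + 2) := by
  induction T with
  | leaf => trivial
  | node a ch ih =>
    refine ⟨rfl, fun j => ?_, fun _ => ⟨a, ?_, fun j hj => ?_⟩, fun j => ?_⟩
    · by_cases h : j = a <;> beta_reduce
      · rw [if_pos h]; exact Or.inl rfl
      · rw [if_neg h]; exact Or.inr rfl
    · simp only [if_true]; rfl
    · by_contra h
      simp only [if_neg h] at hj
      exact hj
    · by_cases h : j = a <;> beta_reduce
      · rw [if_pos h]
        exact ⟨rfl, fun l => root_toTree _, fun h => (nomatch h), ih⟩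
      · rw [if_neg h]; trivial

theorem isMBipartite_toTree (T : WhiteTree k) : T.toTree.IsMBipartite (k + 2) where
  blossoming := by
    have h := excess_toTree T
    rw [PlantedTree.IsBlossoming, PlantedTree.leaves]
    simp only [excess] at h
    simp
    omega
  nodesOK := nodesOK_toTree T
  root_white := by
    cases T with
    | leaf => exact Or.inr rfl
    | node a ch => exact Or.inl rfl

/-- Colours alternate along the tree, so the statements for white and for black tops feed each other
and must be proved together. -/
theorem exists_toTree_of_nodesOK (P : PlantedTree) (hP : P.NodesOK (k + 2)) :
    (P.IsNodeOfColor Color.white ∨ P.IsLeafOfKind LeafKind.closing →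
      ∃ T : WhiteTree k, T.toTree = P) ∧
    (P.IsNodeOfColor Color.black → ∃ ch : Fin (k + 1) → WhiteTree k,
      P = PlantedTree.node Color.black k fun l => (ch l).toTree) := by
  induction P with
  | leaf kind =>
    refine ⟨?_, fun h => h.elim⟩
    rintro (h | h)
    · exact h.elim
    · cases h; exact ⟨leaf, rfl⟩
  | node c k' ch ih =>
    obtain ⟨hk, hallowed, hwhite, hch⟩ := hP
    obtain rfl : k' = k := by omega
    constructor
    · rintro (h | h)
      · cases h
        obtain ⟨a, ha, huniq⟩ := hwhite rfl
        obtain ⟨ch', hch'⟩ := (ih a (hch a)).2 ha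
        refine ⟨node a ch', ?_⟩
        rw [toTree]
        congr 1
        funext j
        split_ifs with hj
        · rw [hj, hch']
        · rcases hallowed j with h | h
          · exact absurd (huniq j h) hj
          · cases hc : ch j with
            | leaf kind => rw [hc] at h; cases h; rfl
            | node _ _ _ => rw [hc] at h; exact h.elim
      · exact h.elim
    · intro h
      cases h
      choose ch' hch' using fun j => (ih j (hch j)).1 (hallowed j)
      exact ⟨ch', by simp only [hch']⟩

/-- The `m`-bipartite trees are the planted trees of the given shapes. -/
noncomputable def equivMBipartite (k : ℕ) :
    WhiteTree k ≃ {P : PlantedTree // P.IsMBipartite (k + 2)} :=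
  Equiv.ofBijective (fun T => ⟨T.toTree, isMBipartite_toTree T⟩)
    ⟨fun _ _ h => toTree_injective (congrArg Subtype.val h), by
      rintro ⟨P, hP⟩
      obtain ⟨T, hT⟩ := (exists_toTree_of_nodesOK P hP.nodesOK).1 (hP.root_white.imp_right (by
        rintro rfl; rfl))
      exact ⟨T, Subtype.ext hT⟩⟩

end WhiteTree

end BlossomMaps

namespace BlossomMaps

/-! ## Forward matchings -/

/-- Values are chosen in order: by monotonicity the `i` values already used lie in `A i`, so exactly
`(A i).card - i` choices remain, whatever the earlier ones were. -/
theorem card_injective_of_monotone {α : Type*} [Finite α] {K : ℕ} (A : Fin K → Finset α)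
    (hA : Monotone A) :
    Nat.card {f : Fin K → α // Function.Injective f ∧ ∀ i, f i ∈ A i} =
      ∏ i : Fin K, ((A i).card - i.1) := by
  classical
  have := Fintype.ofFinite α
  induction K with
  | zero =>
    rw [Finset.univ_eq_empty, Finset.prod_empty, Nat.card_eq_one_iff_unique]
    exact ⟨⟨fun f g => Subtype.ext (Subsingleton.elim _ _)⟩,
      ⟨⟨fun i => i.elim0, fun i => i.elim0, fun i => i.elim0⟩⟩⟩
  | succ K ih =>
    let β := {g : Fin K → α // Function.Injective g ∧ ∀ i, g i ∈ A i.castSucc}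
    let e : {f : Fin (K + 1) → α // Function.Injective f ∧ ∀ i, f i ∈ A i} ≃
        Σ g : β, {x : α // x ∈ A (Fin.last K) \ Finset.univ.image g.1} :=
      { toFun := fun f => ⟨⟨Fin.init f.1, fun i j h => Fin.castSucc_injective _ (f.2.1 h),
            fun i => f.2.2 _⟩, ⟨f.1 (Fin.last K), by
          rw [Finset.mem_sdiff, Finset.mem_image]
          refine ⟨f.2.2 _, ?_⟩
          rintro ⟨i, _, hi⟩
          exact (Fin.castSucc_lt_last i).ne (f.2.1 hi)⟩⟩
        invFun := fun p => ⟨Fin.snoc p.1.1 p.2.1, by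
          rw [Fin.snoc_injective_iff]
          refine ⟨p.1.2.1, ?_⟩
          rintro ⟨i, hi⟩
          exact (Finset.mem_sdiff.mp p.2.2).2 (Finset.mem_image.mpr ⟨i, Finset.mem_univ i, hi⟩), by
          intro i
          refine Fin.lastCases ?_ (fun i => ?_) i
          · rw [Fin.snoc_last]; exact (Finset.mem_sdiff.mp p.2.2).1
          · rw [Fin.snoc_castSucc]; exact p.1.2.2 i⟩
        left_inv := fun f => Subtype.ext (Fin.snoc_init_self f.1)
        right_inv := by
          rintro ⟨⟨g, hg⟩, ⟨x, hx⟩⟩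
          refine Sigma.ext (Subtype.ext (funext fun i => Fin.snoc_castSucc (α := fun _ => α) x g i)) ?_
          refine (Subtype.heq_iff_coe_eq fun y => ?_).mpr
            (Fin.snoc_last (α := fun _ => α) x g)
          simp only [Fin.init_snoc] }
    have : Fintype β := Fintype.ofFinite β
    rw [Nat.card_congr e, Nat.card_sigma, Finset.sum_congr rfl (g := fun _ => (A (Fin.last K)).card - K)]
    · rw [Finset.sum_const, Finset.card_univ, ← Nat.card_eq_fintype_card,
        ih (fun i => A i.castSucc) fun i j h => hA (Fin.castSucc_le_castSucc_iff.mpr h),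
        Fin.prod_univ_castSucc, smul_eq_mul]
      rfl
    · rintro ⟨g, hg⟩ _
      rw [Nat.card_eq_fintype_card, Fintype.card_coe, Finset.card_sdiff_of_subset,
        Finset.card_image_of_injective _ hg.1, Finset.card_univ, Fintype.card_fin]
      intro x hx
      obtain ⟨i, _, rfl⟩ := Finset.mem_image.mp hx
      exact hA (Fin.le_last _) (hg.2 i)

theorem count_take (L : List LeafKind) (x : LeafKind) : ∀ j : ℕ,
    (L.take j).count x = (Finset.univ.filter fun l : Fin L.length => l.1 < j ∧ L.get l = x).card := by
  induction L with
  | nil => intro j; simp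
  | cons y L ih =>
    intro j
    cases j with
    | zero => simp
    | succ j =>
      rw [List.take_succ_cons, List.count_cons, ih]
      refine Eq.trans ?_ (Fin.card_filter_univ_succ' _).symm
      rw [add_comm]
      congr 1
      · simp
      · simp

theorem count_eq_card (L : List LeafKind) (x : LeafKind) :
    L.count x = Fintype.card {l : Fin L.length // L.get l = x} := by
  have h := count_take L x L.length
  rw [List.take_length] at h
  rw [h, Fintype.card_subtype]
  simp

/-- The height of the leaf-path of a word after `j` letters. -/
def wordHeight (L : List LeafKind) (j : ℕ) : ℤ :=
  (L.take j).count LeafKind.opening - (L.take j).count LeafKind.closing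

/-- The starting height is kept general because the tail of a word starts one higher or one lower.
-/
theorem prod_wordHeight_aux (L : List LeafKind) : ∀ i : ℤ,
    (∏ j : Fin L.length, if L.get j = LeafKind.closing then (i + wordHeight L j).toNat else 1) =
      wordWeight i L := by
  induction L with
  | nil => intro i; rfl
  | cons y L ih =>
    intro i
    refine (Fin.prod_univ_succ _).trans ?_
    cases y
    · rw [wordWeight, ← ih]
      simp [wordHeight]
      refine Finset.prod_congr rfl fun j _ => ?_
      congr 2
      ring
    · rw [wordWeight, ← ih]
      simp [wordHeight]
      left
      refine Finset.prod_congr rfl fun j _ => ?_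
      congr 2
      ring

theorem prod_wordHeight (L : List LeafKind) :
    ∏ c : {j : Fin L.length // L.get j = LeafKind.closing}, (wordHeight L c.1).toNat =
      wordWeight 0 L := by
  rw [← prod_wordHeight_aux, ← Finset.prod_filter]
  simp only [zero_add]
  exact (Finset.prod_subtype (Finset.univ.filter fun j : Fin L.length =>
    L.get j = LeafKind.closing) (by simp) fun j => (wordHeight L j).toNat).symm

/-- Closing leaves choose partners from left to right, so the sets of available opening leaves
increase. The `i`-th one sees all openings before it except the `i` already used, and that number is
its height. For unbalanced words both sides vanish. -/
theorem card_forwardMatching (L : List LeafKind)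
    (hL : L.count LeafKind.opening = L.count LeafKind.closing) :
    Nat.card {f : {j : Fin L.length // L.get j = LeafKind.closing} ≃
      {j : Fin L.length // L.get j = LeafKind.opening} // ∀ c, (f c).1 < c.1} = wordWeight 0 L := by
  classical
  rw [← prod_wordHeight]
  set C := {j : Fin L.length // L.get j = LeafKind.closing}
  set O := {j : Fin L.length // L.get j = LeafKind.opening}
  have hcard : Fintype.card C = Fintype.card O := by
    rw [← count_eq_card, ← count_eq_card, hL]
  let e : Fin (Fintype.card C) ≃o C := Fintype.orderIsoFinOfCardEq C rfl
  let A : Fin (Fintype.card C) → Finset O := fun i => Finset.univ.filter fun o => o.1 < (e i).1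
  have hA : Monotone A := fun i j h o ho => by
    simp only [A, Finset.mem_filter, Finset.mem_univ, true_and] at ho ⊢
    exact ho.trans_le (e.monotone h)
  -- Opening and closing leaves being equally many, injectivity suffices.
  let E₁ : {f : C ≃ O // ∀ c, (f c).1 < c.1} ≃
      {f : C → O // Function.Injective f ∧ ∀ c, (f c).1 < c.1} :=
    { toFun := fun f => ⟨f.1, f.1.injective, f.2⟩
      invFun := fun f => ⟨Equiv.ofBijective f.1
        ((Fintype.bijective_iff_injective_and_card f.1).mpr ⟨f.2.1, hcard⟩), f.2.2⟩
      left_inv := fun f => Subtype.ext (Equiv.ext fun _ => rfl)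
      right_inv := fun f => rfl }
  let E₂ : {f : C → O // Function.Injective f ∧ ∀ c, (f c).1 < c.1} ≃
      {f : Fin (Fintype.card C) → O // Function.Injective f ∧ ∀ i, f i ∈ A i} :=
    (Equiv.arrowCongr e.toEquiv.symm (Equiv.refl O)).subtypeEquiv fun f => by
      refine and_congr ?_ ?_
      · exact (Function.Injective.of_comp_iff' f e.toEquiv.bijective).symm
      · rw [← e.toEquiv.forall_congr_right]
        simp [A]
  rw [Nat.card_congr (E₁.trans E₂), card_injective_of_monotone A hA, ← e.toEquiv.prod_comp]
  refine Finset.prod_congr rfl fun i _ => ?_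
  have h1 : (A i).card = (L.take (e i).1).count LeafKind.opening := by
    rw [count_take]
    refine Finset.card_bij (fun o _ => o.1) ?_ ?_ ?_
    · intro o ho
      simp only [A, Finset.mem_filter, Finset.mem_univ, true_and] at ho ⊢
      exact ⟨ho, o.2⟩
    · intro o _ o' _ h; exact Subtype.ext h
    · intro l hl
      simp only [Finset.mem_filter, Finset.mem_univ, true_and] at hl
      exact ⟨⟨l, hl.2⟩, by simpa [A] using hl.1, rfl⟩
  have h2 : i.1 = (L.take (e i).1).count LeafKind.closing := by
    rw [count_take, ← Fin.card_Iio]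
    refine Finset.card_bij (fun j _ => (e j).1) ?_ ?_ ?_
    · intro j hj
      simp only [Finset.mem_filter, Finset.mem_univ, true_and]
      rw [Finset.mem_Iio] at hj
      exact ⟨e.strictMono hj, (e j).2⟩
    · intro o _ o' _ h; exact e.injective (Subtype.ext h)
    · intro l hl
      simp only [Finset.mem_filter, Finset.mem_univ, true_and] at hl
      refine ⟨e.symm ⟨l, hl.2⟩, ?_, by simp⟩
      rw [Finset.mem_Iio, e.symm_apply_lt]
      exact hl.1
  rw [h1]
  conv_lhs => rw [h2]
  rw [wordHeight]
  change _ = (((L.take (e i).1).count LeafKind.opening : ℤ)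
    - (L.take (e i).1).count LeafKind.closing).toNat
  omega

/-! ## Fibres over the underlying tree -/

namespace PlantedTree

/-- The matching-assignments of a tree. -/
def Assignment (T : PlantedTree) : Type :=
  {f : T.ClosingLeaf → ℕ // ∀ c, (f c : ℤ) < T.height c}

/-- The forward matchings of a tree. -/
def ForwardMatching (T : PlantedTree) : Type :=
  {f : T.ClosingLeaf ≃ T.OpeningLeaf // ∀ c, (f c).1 < c.1}

instance (T : PlantedTree) : Fintype T.ClosingLeaf :=
  inferInstanceAs (Fintype {j : Fin T.leaves.length // T.leaves.get j = LeafKind.closing})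

instance (T : PlantedTree) : Fintype T.OpeningLeaf :=
  inferInstanceAs (Fintype {j : Fin T.leaves.length // T.leaves.get j = LeafKind.opening})

/-- Matching-assignments as dependent functions. -/
def assignmentEquiv (T : PlantedTree) :
    T.Assignment ≃ ∀ c : T.ClosingLeaf, Fin (T.height c).toNat where
  toFun f c := ⟨f.1 c, by have := f.2 c; omega⟩
  invFun f := ⟨fun c => f c, fun c => by have h : (f c).1 < _ := (f c).2; exact Int.lt_toNat.mp h⟩
  left_inv _ := rfl
  right_inv _ := rfl

instance (T : PlantedTree) : Finite T.Assignment := Finite.of_equiv _ T.assignmentEquiv.symm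

instance (T : PlantedTree) : Finite T.ForwardMatching := by
  have : Finite (T.ClosingLeaf ≃ T.OpeningLeaf) := Finite.of_injective _ DFunLike.coe_injective
  exact inferInstanceAs (Finite {f : T.ClosingLeaf ≃ T.OpeningLeaf // ∀ c, (f c).1 < c.1})

theorem card_assignment (T : PlantedTree) : Nat.card T.Assignment = wordWeight 0 T.leaves := by
  rw [Nat.card_congr T.assignmentEquiv, Nat.card_pi, ← prod_wordHeight]
  simp only [Nat.card_fin]
  rfl

theorem card_forwardMatching (T : PlantedTree) (hT : T.IsBlossoming) :
    Nat.card T.ForwardMatching = wordWeight 0 T.leaves :=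
  BlossomMaps.card_forwardMatching T.leaves hT

/-- As many matching-assignments as forward matchings. -/
noncomputable def assignmentEquivMatching (T : PlantedTree) (hT : T.IsBlossoming) :
    T.Assignment ≃ T.ForwardMatching :=
  (Finite.card_eq.mp (by rw [card_assignment, card_forwardMatching T hT])).some

end PlantedTree

/-- Enriched trees fibred over the underlying trees. -/
def enrichedTreeEquiv (m : ℕ) :
    EnrichedTree m ≃ Σ T : {T : PlantedTree // T.IsMBipartite m}, T.1.Assignment where
  toFun E := ⟨⟨E.tree, E.isMBipartite⟩, ⟨E.index, E.index_lt⟩⟩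
  -- Balance need not be stored: a natural number below the height forces the height to be positive.
  invFun p := ⟨p.1.1, p.1.2, fun c => by have := p.2.2 c; omega, p.2.1, p.2.2⟩
  left_inv _ := rfl
  right_inv _ := rfl

/-- Matched trees fibred over the underlying trees. -/
def matchedTreeEquiv (m : ℕ) :
    MatchedTree m ≃ Σ T : {T : PlantedTree // T.IsMBipartite m}, T.1.ForwardMatching where
  toFun E := ⟨⟨E.tree, E.isMBipartite⟩, ⟨E.matching, E.forward⟩⟩
  invFun p := ⟨p.1.1, p.1.2, p.2.1, p.2.2⟩
  left_inv _ := rfl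
  right_inv _ := rfl

/-- The bijection between enriched trees and matched trees. -/
noncomputable def enrichedEquivMatched (m : ℕ) : EnrichedTree m ≃ MatchedTree m :=
  (enrichedTreeEquiv m).trans ((Equiv.sigmaCongrRight fun T =>
    T.1.assignmentEquivMatching T.2.blossoming).trans (matchedTreeEquiv m).symm)

theorem tree_enrichedEquivMatched {m : ℕ} (T : EnrichedTree m) :
    (enrichedEquivMatched m T).tree = T.tree := rfl

/-- Enriched trees fibred over the shapes of the underlying trees. -/
noncomputable def enrichedShapeEquiv (k : ℕ) :
    EnrichedTree (k + 2) ≃ Σ T : WhiteTree k, T.toTree.Assignment :=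
  (enrichedTreeEquiv (k + 2)).trans
    (Equiv.sigmaCongrLeft (β := fun T : {T : PlantedTree // T.IsMBipartite (k + 2)} =>
      T.1.Assignment) (WhiteTree.equivMBipartite k)).symm

theorem tree_enrichedShapeEquiv_symm {k : ℕ} (p : Σ T : WhiteTree k, T.toTree.Assignment) :
    ((enrichedShapeEquiv k).symm p).tree = p.1.toTree := rfl

/-- Enriched trees with `n` black nodes, fibred over the shapes of size `n`. -/
noncomputable def enrichedOfSizeEquiv (k n : ℕ) :
    {E : EnrichedTree (k + 2) // E.tree.blackNodes = n} ≃
      Σ T : {T : WhiteTree k // T.size = n}, T.1.toTree.Assignment :=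
  ((enrichedShapeEquiv k).subtypeEquiv (q := fun p => p.1.size = n) fun E => by
    obtain ⟨p, rfl⟩ := (enrichedShapeEquiv k).symm.surjective E
    rw [Equiv.apply_symm_apply, tree_enrichedShapeEquiv_symm, WhiteTree.blackNodes_toTree]).trans
  (Equiv.subtypeSigmaEquiv (fun T : WhiteTree k => T.toTree.Assignment) fun T => T.size = n)

theorem finite_enrichedTree (k n : ℕ) :
    Finite {E : EnrichedTree (k + 2) // E.tree.blackNodes = n} :=
  have : Finite {T : WhiteTree k // T.size = n} := WhiteTree.finite_size_eq k n
  Finite.of_equiv _ (enrichedOfSizeEquiv k n).symm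

theorem card_enrichedTree (k n : ℕ) :
    PowerSeries.coeff n (WhiteTree.series k 1) =
      Nat.card {E : EnrichedTree (k + 2) // E.tree.blackNodes = n} := by
  let _ : Fintype {T : WhiteTree k // T.size = n} :=
    Fintype.subtype (WhiteTree.ofSize k n) fun _ => WhiteTree.mem_ofSize
  rw [Nat.card_congr (enrichedOfSizeEquiv k n), Nat.card_sigma, WhiteTree.series,
    PowerSeries.coeff_mk, Finset.sum_subtype _ fun _ => WhiteTree.mem_ofSize, Nat.cast_sum]
  refine Finset.sum_congr rfl fun T _ => ?_
  rw [PlantedTree.card_assignment, ← WhiteTree.wordWeight_toTree]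
  -- The root leaf raises the path from height `0` to the height `1` at which `series` is evaluated.
  rfl

end BlossomMaps

namespace BlossomMaps

/-! ## Pairs of regular permutations -/

section RegularPerm

open Equiv Function

theorem minimalPeriod_of_injective {α β : Type*} {f : α → α} {g : β → β} {ψ : α → β}
    (hψ : Injective ψ) (h : ∀ x, ψ (f x) = g (ψ x)) (x : α) :
    minimalPeriod g (ψ x) = minimalPeriod f x := by
  rw [minimalPeriod_eq_minimalPeriod_iff]
  intro n
  have h1 : ψ (f^[n] x) = g^[n] (ψ x) := (show Semiconj ψ f g from h).iterate_right n x
  rw [IsPeriodicPt, IsFixedPt, ← h1, hψ.eq_iff]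
  rfl

theorem ncard_sameCycle {α : Type*} [Finite α] (σ : Perm α) (x : α) :
    {y | σ.SameCycle x y}.ncard = minimalPeriod σ x := by
  classical
  have := Fintype.ofFinite α
  have h1 : {y | σ.SameCycle x y} = MulAction.orbit (Subgroup.zpowers σ) x := by
    ext y
    constructor
    · rintro ⟨i, rfl⟩
      exact ⟨⟨σ ^ i, i, rfl⟩, rfl⟩
    · rintro ⟨⟨_, i, rfl⟩, rfl⟩
      exact ⟨i, rfl⟩
  have h2 : Fintype (MulAction.orbit (Subgroup.zpowers σ) x) := Fintype.ofFinite _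
  rw [h1, ← Nat.card_coe_set_eq, Nat.card_eq_fintype_card, ← MulAction.minimalPeriod_eq_card]
  rfl

/-- The permutations all of whose cycles have length `m`. -/
abbrev RegularPerm (m : ℕ) (E : Type*) : Type _ := {σ : Perm E // ∀ x, minimalPeriod σ x = m}

/-- The cycle type does not record fixed points. They are excluded on one side by `2 ≤ m`, on the
other because the cycles already use up all `m * n` elements. -/
theorem regular_iff_cycleType {E : Type*} [Fintype E] [DecidableEq E] {m n : ℕ} (hm : 2 ≤ m)
    (hE : Fintype.card E = m * n) (σ : Perm E) :
    (∀ x, minimalPeriod σ x = m) ↔ σ.cycleType = Multiset.replicate n m := by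
  have hsupp : ∀ x ∈ σ.support, (σ.cycleOf x).support.card = minimalPeriod σ x := by
    intro x hx
    rw [← ncard_sameCycle, ← Set.ncard_coe_finset]
    congr 1
    ext y
    rw [Finset.mem_coe, Perm.mem_support_cycleOf_iff]
    exact and_iff_left hx
  constructor
  · intro h
    have hfull : σ.support = Finset.univ := by
      refine Finset.eq_univ_of_forall fun x => ?_
      rw [Perm.mem_support]
      intro hx
      have : minimalPeriod σ x = 1 := minimalPeriod_eq_one_iff_isFixedPt.mpr hx
      rw [h] at this
      omega
    have hall : ∀ b ∈ σ.cycleType, b = m := by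
      intro b hb
      rw [Perm.cycleType_def, Multiset.mem_map] at hb
      obtain ⟨c, hc, rfl⟩ := hb
      have hc' : c ∈ σ.cycleFactorsFinset := hc
      obtain ⟨x, hx⟩ := (Perm.mem_cycleFactorsFinset_iff.mp hc').1.nonempty_support
      rw [Perm.cycle_is_cycleOf hx hc']
      rw [← h x]
      exact hsupp x (by rw [hfull]; exact Finset.mem_univ x)
    have h1 := Multiset.eq_replicate_of_mem hall
    have h2 := σ.sum_cycleType
    rw [h1, Multiset.sum_replicate, hfull, Finset.card_univ, hE, smul_eq_mul, mul_comm] at h2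
    rw [h1, Nat.eq_of_mul_eq_mul_left (by omega) h2]
  · intro h x
    have h2 := σ.sum_cycleType
    rw [h, Multiset.sum_replicate, smul_eq_mul, mul_comm, ← hE] at h2
    have hx : x ∈ σ.support := by
      rw [Finset.card_eq_iff_eq_univ _ |>.mp h2.symm]
      exact Finset.mem_univ x
    rw [← hsupp x hx]
    have h3 : (σ.cycleOf x).support.card ∈ σ.cycleType := by
      rw [Perm.cycleType_def, Multiset.mem_map]
      exact ⟨σ.cycleOf x, Perm.cycleOf_mem_cycleFactorsFinset_iff.mpr hx, rfl⟩
    rw [h] at h3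
    exact Multiset.eq_of_mem_replicate h3

theorem card_regularPerm {m : ℕ} (hm : 2 ≤ m) (n : ℕ) :
    Nat.card (RegularPerm m (Fin (m * n))) * (m ^ n * n.factorial) = (m * n).factorial := by
  classical
  have h1 : Nat.card (RegularPerm m (Fin (m * n))) =
      (Finset.univ.filter fun σ : Perm (Fin (m * n)) =>
        σ.cycleType = Multiset.replicate n m).card := by
    rw [← Fintype.card_subtype, ← Nat.card_eq_fintype_card]
    exact Nat.card_congr (Equiv.subtypeEquivRight
      fun σ => regular_iff_cycleType hm (Fintype.card_fin _) σ)
  have h2 := Perm.card_of_cycleType_mul_eq (α := Fin (m * n)) (Multiset.replicate n m)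
  rw [if_pos, Fintype.card_fin, Multiset.sum_replicate, Multiset.prod_replicate, smul_eq_mul,
    mul_comm n m, Nat.sub_self, Nat.factorial_zero, one_mul] at h2
  · rw [h1, ← h2]
    congr 2
    rcases Nat.eq_zero_or_pos n with rfl | hn
    · simp
    · rw [Multiset.toFinset_replicate, if_neg hn.ne', Finset.prod_singleton,
        Multiset.count_replicate_self]
  · rw [Multiset.sum_replicate, Fintype.card_fin, smul_eq_mul, mul_comm]
    refine ⟨le_rfl, fun a ha => ?_⟩
    rw [Multiset.eq_of_mem_replicate ha]
    exact hm

/-- The cycles partition the set into blocks of size `m`. -/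
theorem dvd_card_of_regularPerm {m : ℕ} {E : Type*} [Fintype E]
    (σ : RegularPerm m E) : m ∣ Fintype.card E := by
  classical
  have h : ∀ q : Quotient (Perm.SameCycle.setoid σ.1),
      Nat.card {x // Quotient.mk (Perm.SameCycle.setoid σ.1) x = q} = m := by
    intro q
    obtain ⟨x, rfl⟩ := Quotient.exists_rep q
    refine Eq.trans ?_ (σ.2 x)
    rw [← ncard_sameCycle, ← Nat.card_coe_set_eq]
    exact Nat.card_congr (Equiv.subtypeEquivRight fun y =>
      (Quotient.eq (r := Perm.SameCycle.setoid σ.1)).trans ⟨Perm.SameCycle.symm, Perm.SameCycle.symm⟩)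
  have : Fintype (Quotient (Perm.SameCycle.setoid σ.1)) := Fintype.ofFinite _
  rw [← Nat.card_eq_fintype_card,
    ← Nat.card_congr (Equiv.sigmaFiberEquiv (Quotient.mk (Perm.SameCycle.setoid σ.1))),
    Nat.card_sigma, Finset.sum_congr rfl fun q _ => h q, Finset.sum_const, smul_eq_mul]
  exact Dvd.intro_left _ rfl

/-! ### Components of pairs of permutations. -/

/-- The elements that can be reached from `e` by applying the two permutations. -/
inductive Reach {E : Type*} (σ τ : Perm E) (e : E) : E → Prop
  | refl : Reach σ τ e e
  | left {y : E} : Reach σ τ e y → Reach σ τ e (σ y)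
  | right {y : E} : Reach σ τ e y → Reach σ τ e (τ y)

theorem Reach.map {E E' : Type*} {σ τ : Perm E} {σ' τ' : Perm E'} {ψ : E → E'}
    (hσ : ∀ x, ψ (σ x) = σ' (ψ x)) (hτ : ∀ x, ψ (τ x) = τ' (ψ x)) {e y : E}
    (h : Reach σ τ e y) : Reach σ' τ' (ψ e) (ψ y) := by
  induction h with
  | refl => exact Reach.refl
  | left _ ih => rw [hσ]; exact ih.left
  | right _ ih => rw [hτ]; exact ih.right

/-- Pairs of regular permutations with a marked element that reaches all others. -/
abbrev RootedPair (m : ℕ) (E : Type*) : Type _ :=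
  {t : RegularPerm m E × RegularPerm m E × E // ∀ y, Reach t.1.1 t.2.1.1 t.2.2 y}

/-- Transport of regular permutations. -/
def RegularPerm.congr {m : ℕ} {E E' : Type*} (ψ : E ≃ E') : RegularPerm m E ≃ RegularPerm m E' :=
  ψ.permCongr.subtypeEquiv fun σ => by
    rw [← ψ.forall_congr_right]
    refine forall_congr' fun x => ?_
    rw [minimalPeriod_of_injective (f := σ) ψ.injective fun x => by simp]

theorem RegularPerm.congr_apply {m : ℕ} {E E' : Type*} (ψ : E ≃ E') (σ : RegularPerm m E) (x : E) :
    (RegularPerm.congr ψ σ).1 (ψ x) = ψ (σ.1 x) := by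
  change ψ.permCongr σ.1 (ψ x) = _
  simp

/-- Transport of rooted pairs. -/
def RootedPair.congr {m : ℕ} {E E' : Type*} (ψ : E ≃ E') : RootedPair m E ≃ RootedPair m E' :=
  (Equiv.prodCongr (RegularPerm.congr ψ) (Equiv.prodCongr (RegularPerm.congr ψ) ψ)).subtypeEquiv
    fun t => by
      rw [← ψ.forall_congr_right]
      refine forall_congr' fun y => ⟨fun h => ?_, fun h => ?_⟩
      · exact h.map (fun x => (RegularPerm.congr_apply ψ _ x).symm)
          fun x => (RegularPerm.congr_apply ψ _ x).symm
      · have := h.map (σ' := t.1.1) (τ' := t.2.1.1) (ψ := ψ.symm)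
          (fun x => by
            obtain ⟨x, rfl⟩ := ψ.surjective x
            exact (congrArg ψ.symm (RegularPerm.congr_apply ψ t.1 x)).trans (by simp))
          (fun x => by
            obtain ⟨x, rfl⟩ := ψ.surjective x
            exact (congrArg ψ.symm (RegularPerm.congr_apply ψ t.2.1 x)).trans (by simp))
        simpa using this

variable {m : ℕ} {E : Type*}

theorem mem_iff_of_mapsTo {S : Finset E} (σ : Perm E) (h : ∀ x ∈ S, σ x ∈ S) (x : E) :
    σ x ∈ S ↔ x ∈ S := by
  refine ⟨fun hx => ?_, h x⟩
  have h1 : S.map σ.toEmbedding = S :=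
    Finset.eq_of_subset_of_card_le (fun y hy => by
      obtain ⟨z, hz, rfl⟩ := Finset.mem_map.mp hy
      exact h z hz) (by rw [Finset.card_map])
  rw [← h1, Finset.mem_map] at hx
  obtain ⟨z, hz, hzx⟩ := hx
  rwa [← σ.injective hzx]

/-- Juxtaposition of regular permutations on a set and on its complement. -/
def RegularPerm.glue [DecidableEq E] (S : Finset E) (σ : RegularPerm m {x // x ∈ S})
    (σ' : RegularPerm m {x // x ∉ S}) : RegularPerm m E :=
  ⟨σ.1.subtypeCongr σ'.1, fun x => by
    by_cases hx : x ∈ S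
    · refine Eq.trans ?_ (σ.2 ⟨x, hx⟩)
      exact minimalPeriod_of_injective (ψ := Subtype.val) Subtype.val_injective
        (fun y => (Perm.subtypeCongr.left_apply_subtype σ.1 σ'.1 y).symm) ⟨x, hx⟩
    · refine Eq.trans ?_ (σ'.2 ⟨x, hx⟩)
      exact minimalPeriod_of_injective (ψ := Subtype.val) Subtype.val_injective
        (fun y => (Perm.subtypeCongr.right_apply_subtype σ.1 σ'.1 y).symm) ⟨x, hx⟩⟩

theorem RegularPerm.glue_left [DecidableEq E] {S : Finset E} (σ : RegularPerm m {x // x ∈ S})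
    (σ' : RegularPerm m {x // x ∉ S}) (x : {x // x ∈ S}) :
    ((σ.1 x : {x // x ∈ S}) : E) = (σ.glue S σ').1 x :=
  (Perm.subtypeCongr.left_apply_subtype σ.1 σ'.1 x).symm

theorem RegularPerm.glue_injective [DecidableEq E] {S : Finset E} {σ τ : RegularPerm m {x // x ∈ S}}
    {σ' τ' : RegularPerm m {x // x ∉ S}} (h : σ.glue S σ' = τ.glue S τ') : σ = τ ∧ σ' = τ' := by
  have h1 := Perm.subtypeCongrHom_injective (· ∈ S) (a₁ := (σ.1, σ'.1)) (a₂ := (τ.1, τ'.1))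
    (congrArg Subtype.val h)
  rw [Prod.mk.injEq] at h1
  exact ⟨Subtype.ext h1.1, Subtype.ext h1.2⟩

theorem RegularPerm.exists_glue [DecidableEq E] {S : Finset E} (σ : RegularPerm m E) (h : ∀ x ∈ S, σ.1 x ∈ S) :
    ∃ (σ₁ : RegularPerm m {x // x ∈ S}) (σ₂ : RegularPerm m {x // x ∉ S}), σ₁.glue S σ₂ = σ := by
  have h1 := mem_iff_of_mapsTo σ.1 h
  refine ⟨⟨σ.1.subtypePerm h1, fun x => ?_⟩,
    ⟨σ.1.subtypePerm (p := (· ∉ S)) fun x => not_congr (h1 x), fun x => ?_⟩, ?_⟩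
  · refine Eq.trans ?_ (σ.2 x)
    exact (minimalPeriod_of_injective (ψ := Subtype.val) Subtype.val_injective
      (fun y => rfl) x).symm
  · refine Eq.trans ?_ (σ.2 x)
    exact (minimalPeriod_of_injective (ψ := Subtype.val) Subtype.val_injective
      (fun y => rfl) x).symm
  · refine Subtype.ext (Equiv.ext fun x => ?_)
    change Perm.subtypeCongr _ _ x = _
    rw [Perm.subtypeCongr.apply]
    split_ifs <;> rfl

open Classical in
/-- The component of the marked element. -/
noncomputable def component [Fintype E] (t : RegularPerm m E × RegularPerm m E × E) : Finset E :=
  Finset.univ.filter fun y => Reach t.1.1 t.2.1.1 t.2.2 y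

theorem mem_component [Fintype E] {t : RegularPerm m E × RegularPerm m E × E} {y : E} :
    y ∈ component t ↔ Reach t.1.1 t.2.1.1 t.2.2 y := by
  simp [component]

/-- Such a triple splits uniquely into a rooted transitive pair on `S` and an arbitrary pair on the
complement, since both permutations preserve `S`. -/
theorem card_component_eq [Fintype E] [DecidableEq E] (S : Finset E) :
    Nat.card {t : RegularPerm m E × RegularPerm m E × E // component t = S} =
      Nat.card (RootedPair m {x // x ∈ S}) * Nat.card (RegularPerm m {x // x ∉ S}) ^ 2 := by
  rw [pow_two, ← Nat.card_prod, ← Nat.card_prod]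
  symm
  let G : RootedPair m {x // x ∈ S} × RegularPerm m {x // x ∉ S} × RegularPerm m {x // x ∉ S} →
      RegularPerm m E × RegularPerm m E × E := fun p =>
    (p.1.1.1.glue S p.2.1, p.1.1.2.1.glue S p.2.2, p.1.1.2.2.1)
  have hG : ∀ p, component (G p) = S := by
    intro p
    ext y
    rw [mem_component]
    constructor
    · intro h
      induction h with
      | refl => exact p.1.1.2.2.2
      | @left y _ ih =>
        have := RegularPerm.glue_left p.1.1.1 p.2.1 ⟨y, ih⟩
        simp only [G]
        rw [← this]
        exact Subtype.property _
      | @right y _ ih =>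
        have := RegularPerm.glue_left p.1.1.2.1 p.2.2 ⟨y, ih⟩
        simp only [G]
        rw [← this]
        exact Subtype.property _
    · intro h
      exact (p.1.2 ⟨y, h⟩).map (ψ := Subtype.val) (fun x => RegularPerm.glue_left _ _ x)
        fun x => RegularPerm.glue_left _ _ x
  refine Nat.card_eq_of_bijective (fun p => ⟨G p, hG p⟩) ⟨?_, ?_⟩
  · rintro ⟨⟨⟨σ, τ, e⟩, h⟩, σ', τ'⟩ ⟨⟨⟨σ₂, τ₂, e₂⟩, h₂⟩, σ₂', τ₂'⟩ heq
    have h1 := congrArg Subtype.val heq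
    simp only [G, Prod.mk.injEq] at h1
    obtain ⟨rfl, rfl⟩ := RegularPerm.glue_injective h1.1
    obtain ⟨rfl, rfl⟩ := RegularPerm.glue_injective h1.2.1
    obtain rfl := Subtype.ext h1.2.2
    rfl
  · rintro ⟨⟨σ, τ, e⟩, hS⟩
    have hmem : ∀ y, y ∈ S ↔ Reach σ.1 τ.1 e y := fun y => by rw [← hS, mem_component]
    obtain ⟨σ₁, σ₂, rfl⟩ := σ.exists_glue (S := S) fun x hx => (hmem _).mpr ((hmem x).mp hx).left
    obtain ⟨τ₁, τ₂, rfl⟩ := τ.exists_glue (S := S) fun x hx => (hmem _).mpr ((hmem x).mp hx).right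
    have he : e ∈ S := (hmem e).mpr Reach.refl
    -- A path from `e` stays in `S`, so it lifts to the restricted permutations.
    have key : ∀ y, Reach (σ₁.glue S σ₂).1 (τ₁.glue S τ₂).1 e y →
        ∃ h : y ∈ S, Reach σ₁.1 τ₁.1 ⟨e, he⟩ ⟨y, h⟩ := by
      intro y hy
      induction hy with
      | refl => exact ⟨he, Reach.refl⟩
      | @left y _ ih =>
        obtain ⟨h, hr⟩ := ih
        have h1 := RegularPerm.glue_left σ₁ σ₂ ⟨y, h⟩
        refine ⟨h1 ▸ Subtype.property _, ?_⟩
        convert hr.left using 1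
        exact Subtype.ext h1.symm
      | @right y _ ih =>
        obtain ⟨h, hr⟩ := ih
        have h1 := RegularPerm.glue_left τ₁ τ₂ ⟨y, h⟩
        refine ⟨h1 ▸ Subtype.property _, ?_⟩
        convert hr.right using 1
        exact Subtype.ext h1.symm
    exact ⟨(⟨(σ₁, τ₁, ⟨e, he⟩), fun y => (key y ((hmem y).mp y.2)).2⟩, σ₂, τ₂), rfl⟩

/-- Pairs with a marked element are sorted by the component of that element; the count depends only
on its size. -/
theorem card_regularPerm_sq (m N : ℕ) :
    N * Nat.card (RegularPerm m (Fin N)) ^ 2 = ∑ s ∈ Finset.range (N + 1), N.choose s *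
      (Nat.card (RootedPair m (Fin s)) * Nat.card (RegularPerm m (Fin (N - s))) ^ 2) := by
  have h1 : N * Nat.card (RegularPerm m (Fin N)) ^ 2 =
      Nat.card (RegularPerm m (Fin N) × RegularPerm m (Fin N) × Fin N) := by
    rw [Nat.card_prod, Nat.card_prod, Nat.card_fin]; ring
  rw [h1, ← Nat.card_congr (Equiv.sigmaFiberEquiv component), Nat.card_sigma]
  have h2 : ∀ S : Finset (Fin N), Nat.card {t : RegularPerm m (Fin N) × RegularPerm m (Fin N) ×
      Fin N // component t = S} = Nat.card (RootedPair m (Fin S.card)) *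
        Nat.card (RegularPerm m (Fin (N - S.card))) ^ 2 := by
    intro S
    rw [card_component_eq, Nat.card_congr (RootedPair.congr S.equivFin),
      Nat.card_congr (RegularPerm.congr (Fintype.equivFinOfCardEq _))]
    rw [Fintype.card_subtype_compl, Fintype.card_coe, Fintype.card_fin]
  rw [Finset.sum_congr rfl fun S _ => h2 S, ← Finset.powerset_univ,
    Finset.sum_powerset_apply_card (fun s => Nat.card (RootedPair m (Fin s)) *
        Nat.card (RegularPerm m (Fin (N - s))) ^ 2), Finset.card_univ, Fintype.card_fin]
  simp only [smul_eq_mul]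

end RegularPerm

end BlossomMaps

namespace BlossomMaps

/-! ## Rooted maps as rooted pairs of permutations -/

open Equiv Function

namespace LabelledMap

variable {m : ℕ}

theorem color_opp_eq_white (M : LabelledMap m) (h : Fin M.size) :
    M.color (M.opp h) = Color.white ↔ M.color h = Color.black := by
  have := M.color_opp h
  cases h1 : M.color (M.opp h) <;> cases h2 : M.color h <;> simp_all

theorem color_opp_eq_black (M : LabelledMap m) (h : Fin M.size) :
    M.color (M.opp h) = Color.black ↔ M.color h = Color.white := by
  rw [← color_opp_eq_white, M.opp_opp]

theorem minimalPeriod_rot (M : LabelledMap m) (h : Fin M.size) : minimalPeriod M.rot h = m := by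
  rw [← ncard_sameCycle, M.regular]

/-- The half-edges at white vertices. -/
abbrev WhiteHalfEdge (M : LabelledMap m) : Type := {h : Fin M.size // M.color h = Color.white}

/-- The rotation around white vertices. -/
def whiteRot (M : LabelledMap m) : RegularPerm m M.WhiteHalfEdge :=
  ⟨M.rot.subtypePerm fun h => by rw [M.color_rot], fun h => by
    refine Eq.trans ?_ (M.minimalPeriod_rot h.1)
    exact (minimalPeriod_of_injective (ψ := Subtype.val) Subtype.val_injective
      (fun _ => rfl) h).symm⟩

/-- The rotation around black vertices, transported to the opposite half-edges. -/
def blackRot (M : LabelledMap m) : RegularPerm m M.WhiteHalfEdge :=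
  ⟨(M.opp * M.rot * M.opp).subtypePerm fun h => by
    rw [Perm.mul_apply, Perm.mul_apply, color_opp_eq_white, M.color_rot, color_opp_eq_black],
  fun h => by
    refine Eq.trans ?_ (M.minimalPeriod_rot (M.opp h.1))
    rw [← minimalPeriod_of_injective (ψ := Subtype.val)
      (g := M.opp * M.rot * M.opp) Subtype.val_injective (fun _ => rfl) h]
    exact (minimalPeriod_of_injective M.opp.injective
      (fun x => by simp [M.opp_opp]) h.1).symm⟩

/-- Connectivity concerns the group generated on all half-edges. It is transferred to edges, each
represented by its white half. -/
theorem reach_whiteRot_blackRot (M : LabelledMap m) (w : M.WhiteHalfEdge) :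
    Reach M.whiteRot.1 M.blackRot.1 ⟨M.root, M.color_root⟩ w := by
  set R := Reach M.whiteRot.1 M.blackRot.1 ⟨M.root, M.color_root⟩
  -- The half-edges whose edge has a reachable white half; it is stable under both generators.
  let S : Set (Fin M.size) := {h | (∀ hw : M.color h = Color.white, R ⟨h, hw⟩) ∧
    ∀ hb : M.color h = Color.black, R ⟨M.opp h, (M.color_opp_eq_white h).mpr hb⟩}
  have hrot : Set.MapsTo M.rot S S := by
    intro h hh
    constructor
    · intro hw
      have hw' : M.color h = Color.white := by rwa [M.color_rot] at hw
      exact (hh.1 hw').left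
    · intro hb
      have hb' : M.color h = Color.black := by rwa [M.color_rot] at hb
      have h1 := (hh.2 hb').right
      have h2 : M.blackRot.1 ⟨M.opp h, (M.color_opp_eq_white h).mpr hb'⟩ =
          ⟨M.opp (M.rot h), (M.color_opp_eq_white _).mpr hb⟩ := by
        refine Subtype.ext ?_
        change M.opp (M.rot (M.opp (M.opp h))) = _
        rw [M.opp_opp]
      rwa [h2] at h1
  have hopp : Set.MapsTo M.opp S S := by
    intro h hh
    constructor
    · intro hw
      exact hh.2 ((M.color_opp_eq_white h).mp hw)
    · intro hb
      have h1 := hh.1 ((M.color_opp_eq_black h).mp hb)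
      simp only [M.opp_opp]
      exact h1
  have key : ∀ g ∈ Subgroup.closure {M.rot, M.opp}, Set.MapsTo g S S := by
    intro g hg
    induction hg using Subgroup.closure_induction with
    | mem x hx =>
      rcases hx with rfl | rfl
      · exact hrot
      · exact hopp
    | one => exact fun _ h => h
    | mul x y _ _ hx hy => exact hx.comp hy
    -- On a finite set, a permutation mapping `S` into itself also has an inverse that does so.
    | inv x _ hx => exact Perm.perm_symm_mapsTo_of_mapsTo x hx
  have hroot : M.root ∈ S := ⟨fun _ => Reach.refl, fun hb => by
    rw [M.color_root] at hb; exact absurd hb (by simp)⟩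
  obtain ⟨g, hg, hgw⟩ := M.connected M.root w.1
  have := key g hg hroot
  rw [hgw] at this
  exact this.1 w.2

/-- The rooted pair of permutations of the white half-edges that encodes a map. -/
def whitePair (M : LabelledMap m) : RootedPair m M.WhiteHalfEdge :=
  ⟨(M.whiteRot, M.blackRot, ⟨M.root, M.color_root⟩), M.reach_whiteRot_blackRot⟩

variable {N : ℕ}

/-- The map with edges `Fin N` encoded by a rooted pair, with the given labelling of its white and
black half-edges. -/
def ofLabelling {s : ℕ} (ε : Fin N ⊕ Fin N ≃ Fin s) (t : RootedPair m (Fin N)) : LabelledMap m where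
  size := s
  rot := ε.permCongr (Equiv.sumCongr t.1.1.1 t.1.2.1.1)
  opp := ε.permCongr (Equiv.sumComm _ _)
  opp_opp h := by simp
  opp_ne h := by
    obtain ⟨y, rfl⟩ := ε.surjective h
    cases y <;> simp [ε.injective.eq_iff]
  connected := by
    set rot : Perm (Fin s) := ε.permCongr (Equiv.sumCongr t.1.1.1 t.1.2.1.1)
    set opp : Perm (Fin s) := ε.permCongr (Equiv.sumComm _ _)
    have hrot : rot ∈ Subgroup.closure {rot, opp} := Subgroup.subset_closure (by simp)
    have hopp : opp ∈ Subgroup.closure {rot, opp} := Subgroup.subset_closure (by simp)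
    have h1 : ∀ y, ∃ g ∈ Subgroup.closure {rot, opp},
        g (ε (Sum.inl t.1.2.2)) = ε (Sum.inl y) := by
      intro y
      induction t.2 y with
      | refl => exact ⟨1, one_mem _, rfl⟩
      | left _ ih =>
        obtain ⟨g, hg, hgy⟩ := ih
        refine ⟨rot * g, mul_mem hrot hg, ?_⟩
        rw [Perm.mul_apply, hgy]
        simp [rot]
      | right _ ih =>
        obtain ⟨g, hg, hgy⟩ := ih
        -- Cross the edge, turn around the black end, cross back.
        refine ⟨opp * (rot * (opp * g)), mul_mem hopp (mul_mem hrot (mul_mem hopp hg)), ?_⟩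
        rw [Perm.mul_apply, Perm.mul_apply, Perm.mul_apply, hgy]
        simp [rot, opp]
    have h2 : ∀ h, ∃ g ∈ Subgroup.closure {rot, opp}, g (ε (Sum.inl t.1.2.2)) = h := by
      intro h
      obtain ⟨y, rfl⟩ := ε.surjective h
      rcases y with y | y
      · exact h1 y
      · obtain ⟨g, hg, hgy⟩ := h1 y
        refine ⟨opp * g, mul_mem hopp hg, ?_⟩
        rw [Perm.mul_apply, hgy]
        simp [opp]
    intro h h'
    obtain ⟨g, hg, rfl⟩ := h2 h
    obtain ⟨g', hg', rfl⟩ := h2 h'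
    exact ⟨g' * g⁻¹, mul_mem hg' (inv_mem hg), by simp⟩
  root := ε (Sum.inl t.1.2.2)
  color h := Sum.elim (fun _ => Color.white) (fun _ => Color.black) (ε.symm h)
  color_rot h := by
    obtain ⟨y, rfl⟩ := ε.surjective h
    cases y <;> simp
  color_opp h := by
    obtain ⟨y, rfl⟩ := ε.surjective h
    cases y <;> simp
  color_root := by simp
  regular h := by
    rw [ncard_sameCycle]
    obtain ⟨y, rfl⟩ := ε.surjective h
    rcases y with y | y
    · refine Eq.trans ?_ (t.1.1.2 y)
      exact minimalPeriod_of_injective (ψ := fun y => ε (Sum.inl y))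
        (ε.injective.comp Sum.inl_injective) (fun x => by simp) y
    · refine Eq.trans ?_ (t.1.2.1.2 y)
      exact minimalPeriod_of_injective (ψ := fun y => ε (Sum.inr y))
        (ε.injective.comp Sum.inr_injective) (fun x => by simp) y

/-- The map with edges `Fin N` encoded by a rooted pair. -/
def ofRootedPair (t : RootedPair m (Fin N)) : LabelledMap m := ofLabelling finSumFinEquiv t

/-- The labelling of the half-edges of the map encoded by a rooted pair. -/
def halfEdge (t : RootedPair m (Fin N)) : Fin N ⊕ Fin N ≃ Fin (ofRootedPair t).size :=
  finSumFinEquiv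

theorem ofRootedPair_rot_inl (t : RootedPair m (Fin N)) (y : Fin N) :
    (ofRootedPair t).rot (halfEdge t (Sum.inl y)) = halfEdge t (Sum.inl (t.1.1.1 y)) := by
  refine congrArg finSumFinEquiv ?_
  change Sum.map _ _ (finSumFinEquiv.symm (finSumFinEquiv _)) = _
  rw [symm_apply_apply]
  rfl

theorem ofRootedPair_rot_inr (t : RootedPair m (Fin N)) (y : Fin N) :
    (ofRootedPair t).rot (halfEdge t (Sum.inr y)) = halfEdge t (Sum.inr (t.1.2.1.1 y)) := by
  refine congrArg finSumFinEquiv ?_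
  change Sum.map _ _ (finSumFinEquiv.symm (finSumFinEquiv _)) = _
  rw [symm_apply_apply]
  rfl

theorem ofRootedPair_opp (t : RootedPair m (Fin N)) (y : Fin N ⊕ Fin N) :
    (ofRootedPair t).opp (halfEdge t y) = halfEdge t y.swap := by
  refine congrArg finSumFinEquiv ?_
  change (finSumFinEquiv.symm (finSumFinEquiv _)).swap = _
  rw [symm_apply_apply]

theorem ofRootedPair_color (t : RootedPair m (Fin N)) (y : Fin N ⊕ Fin N) :
    (ofRootedPair t).color (halfEdge t y) =
      Sum.elim (fun _ => Color.white) (fun _ => Color.black) y := by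
  change Sum.elim _ _ (finSumFinEquiv.symm (finSumFinEquiv y)) = _
  rw [symm_apply_apply]

/-- A labelling of the white halves labels the edges, hence also the black halves through `opp`;
this is the isomorphism. -/
theorem ofRootedPair_congr_equiv (M : LabelledMap m) (ψ : M.WhiteHalfEdge ≃ Fin N) :
    ofRootedPair (RootedPair.congr ψ M.whitePair) ≈ M := by
  let f : Fin N ⊕ Fin N → Fin M.size :=
    Sum.elim (fun y => (ψ.symm y).1) fun y => M.opp (ψ.symm y).1
  have hf : Bijective f := by
    constructor
    · rintro (x | x) (y | y) h
      · simpa [f, Subtype.val_inj] using h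
      · have h1 := (ψ.symm x).2
        rw [show (ψ.symm x).1 = M.opp (ψ.symm y).1 from h, color_opp_eq_white,
          (ψ.symm y).2] at h1
        exact absurd h1 (by simp)
      · have h1 := (ψ.symm y).2
        rw [← show M.opp (ψ.symm x).1 = (ψ.symm y).1 from h, color_opp_eq_white,
          (ψ.symm x).2] at h1
        exact absurd h1 (by simp)
      · simpa [f, Subtype.val_inj] using h
    · intro h
      cases hc : M.color h
      · exact ⟨Sum.inl (ψ ⟨h, hc⟩), by simp [f]⟩
      · exact ⟨Sum.inr (ψ ⟨M.opp h, (M.color_opp_eq_white h).mpr hc⟩), by simp [f, M.opp_opp]⟩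
  have hψ : ∀ (σ : RegularPerm m M.WhiteHalfEdge) (y : Fin N),
      ψ.symm ((RegularPerm.congr ψ σ).1 y) = σ.1 (ψ.symm y) := by
    intro σ y
    obtain ⟨w, rfl⟩ := ψ.surjective y
    rw [RegularPerm.congr_apply, symm_apply_apply, symm_apply_apply]
  set t := RootedPair.congr ψ M.whitePair with ht
  let Φ : Fin (ofRootedPair t).size ≃ Fin M.size := (halfEdge t).symm.trans (Equiv.ofBijective f hf)
  have hΦ : ∀ y, Φ ((halfEdge t) y) = f y := fun y => by simp [Φ]
  refine ⟨Φ, ?_, ?_, ?_, ?_⟩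
  · intro h
    obtain ⟨y, rfl⟩ := (halfEdge t).surjective h
    rcases y with y | y
    · rw [ofRootedPair_rot_inl, hΦ, hΦ]
      exact congrArg Subtype.val (hψ M.whiteRot y)
    · rw [ofRootedPair_rot_inr, hΦ, hΦ]
      refine (congrArg (fun w => M.opp w.1) (hψ M.blackRot y)).trans ?_
      exact M.opp_opp _
  · intro h
    obtain ⟨y, rfl⟩ := (halfEdge t).surjective h
    rw [ofRootedPair_opp, hΦ, hΦ]
    rcases y with y | y
    · rfl
    · exact (M.opp_opp _).symm
  · change Φ (halfEdge t (Sum.inl (ψ ⟨M.root, M.color_root⟩))) = _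
    rw [hΦ]
    simp [f]
  · intro h
    obtain ⟨y, rfl⟩ := (halfEdge t).surjective h
    rw [ofRootedPair_color, hΦ]
    rcases y with y | y
    · exact (ψ.symm y).2
    · exact (M.color_opp_eq_black _).mpr (ψ.symm y).2

/-- An isomorphism preserves colours, so it restricts to a labelling of the white half-edges, and
compatibility with `rot` and `opp` gives back the pair. -/
theorem exists_congr_of_equiv (M : LabelledMap m) {t : RootedPair m (Fin N)}
    (h : ofRootedPair t ≈ M) : ∃ ψ : M.WhiteHalfEdge ≃ Fin N, RootedPair.congr ψ M.whitePair = t := by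
  obtain ⟨Φ, hΦ⟩ := h
  have hw : ∀ y, M.color (Φ (halfEdge t (Sum.inl y))) = Color.white := fun y => by
    rw [hΦ.map_color, ofRootedPair_color]; rfl
  let f : Fin N → M.WhiteHalfEdge := fun y => ⟨Φ (halfEdge t (Sum.inl y)), hw y⟩
  have hf : Bijective f := by
    constructor
    · intro x y h
      exact Sum.inl_injective ((halfEdge t).injective (Φ.injective (congrArg Subtype.val h)))
    · rintro ⟨h, hh⟩
      obtain ⟨z, rfl⟩ := Φ.surjective h
      obtain ⟨y, rfl⟩ := (halfEdge t).surjective z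
      rcases y with y | y
      · exact ⟨y, rfl⟩
      · rw [hΦ.map_color, ofRootedPair_color] at hh
        exact absurd hh (by simp)
  have hext : ∀ (σ : RegularPerm m M.WhiteHalfEdge) (σ' : RegularPerm m (Fin N)),
      (∀ y, σ.1 (f y) = f (σ'.1 y)) → RegularPerm.congr (Equiv.ofBijective f hf).symm σ = σ' := by
    intro σ σ' hs
    refine Subtype.ext (Equiv.ext fun y => ?_)
    obtain ⟨w, rfl⟩ := (Equiv.ofBijective f hf).symm.surjective y
    rw [RegularPerm.congr_apply, symm_apply_eq]
    obtain ⟨y, rfl⟩ := (Equiv.ofBijective f hf).surjective w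
    rw [symm_apply_apply]
    exact hs y
  refine ⟨(Equiv.ofBijective f hf).symm, Subtype.ext (Prod.ext ?_ (Prod.ext ?_ ?_))⟩
  · refine hext _ _ fun y => Subtype.ext ?_
    change M.rot (Φ _) = Φ _
    rw [← hΦ.map_rot, ofRootedPair_rot_inl]
  · refine hext _ _ fun y => Subtype.ext ?_
    change M.opp (M.rot (M.opp (Φ _))) = Φ _
    rw [← hΦ.map_opp, ← hΦ.map_rot, ← hΦ.map_opp, ofRootedPair_opp, Sum.swap_inl,
      ofRootedPair_rot_inr, ofRootedPair_opp, Sum.swap_inr]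
  · change (Equiv.ofBijective f hf).symm ⟨M.root, M.color_root⟩ = _
    rw [symm_apply_eq]
    exact Subtype.ext hΦ.map_root.symm

/-- Rigidity of rooted maps: two labellings yielding the same pair agree at the root, and agreement
propagates along both permutations. -/
theorem congr_whitePair_injective (M : LabelledMap m) :
    Injective fun ψ : M.WhiteHalfEdge ≃ Fin N => RootedPair.congr ψ M.whitePair := by
  intro ψ ψ' h
  have h1 := congrArg Subtype.val h
  have hσ : RegularPerm.congr ψ M.whiteRot = RegularPerm.congr ψ' M.whiteRot :=
    congrArg (fun t => t.1) h1
  have hτ : RegularPerm.congr ψ M.blackRot = RegularPerm.congr ψ' M.blackRot :=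
    congrArg (fun t => t.2.1) h1
  refine Equiv.ext fun w => ?_
  induction M.reach_whiteRot_blackRot w with
  | refl => exact congrArg (fun t => t.2.2) h1
  | left _ ih => rw [← RegularPerm.congr_apply, ← RegularPerm.congr_apply, hσ, ih]
  | right _ ih => rw [← RegularPerm.congr_apply, ← RegularPerm.congr_apply, hτ, ih]

theorem color_eq_of_sameCycle (M : LabelledMap m) {x y : Fin M.size} (h : M.rot.SameCycle x y) :
    M.color y = M.color x := by
  obtain ⟨n, -, rfl⟩ := h.exists_pow_eq'
  clear h
  induction n with
  | zero => rfl
  | succ n ih => rw [pow_succ', Perm.mul_apply, M.color_rot, ih]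

/-- Each white half-edge is opposite to one black half-edge, and the black ones are grouped by `m`
around their vertices. -/
theorem card_whiteHalfEdge (M : LabelledMap m) :
    Nat.card M.WhiteHalfEdge = m * M.blackVertices := by
  let B := {h : Fin M.size // M.color h = Color.black}
  have h1 : Nat.card M.WhiteHalfEdge = Nat.card B :=
    Nat.card_congr (M.opp.subtypeEquiv fun h => (M.color_opp_eq_black h).symm)
  let V := {v : M.Vertex // ∃ h, M.color h = Color.black ∧ Quotient.mk _ h = v}
  let f : B → V := fun b => ⟨Quotient.mk _ b.1, b.1, b.2, rfl⟩
  have hV : Finite V := by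
    have : Finite M.Vertex := inferInstanceAs (Finite (Quotient _))
    exact Subtype.finite
  have : Fintype V := Fintype.ofFinite V
  have h2 : ∀ v : V, Nat.card {b // f b = v} = m := by
    rintro ⟨v, h, hb, rfl⟩
    refine Eq.trans ?_ (M.regular h)
    rw [← Nat.card_coe_set_eq]
    have hiff : ∀ y, (Quotient.mk (Perm.SameCycle.setoid M.rot) y = Quotient.mk _ h) ↔
        M.rot.SameCycle h y := fun y => Quotient.eq.trans ⟨Perm.SameCycle.symm, Perm.SameCycle.symm⟩
    exact Nat.card_congr
      { toFun := fun b => ⟨b.1.1, (hiff _).mp (congrArg Subtype.val b.2)⟩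
        invFun := fun y => ⟨⟨y.1, (M.color_eq_of_sameCycle y.2).trans hb⟩,
          Subtype.ext ((hiff _).mpr y.2)⟩
        left_inv := fun _ => rfl
        right_inv := fun _ => rfl }
  rw [h1, ← Nat.card_congr (Equiv.sigmaFiberEquiv f), Nat.card_sigma,
    Finset.sum_congr rfl fun v _ => h2 v, Finset.sum_const, smul_eq_mul, Finset.card_univ,
    ← Nat.card_eq_fintype_card, mul_comm]
  rfl

end LabelledMap

open LabelledMap

theorem blackVertices_ofRootedPair {m : ℕ} (hm : 0 < m) {n : ℕ} (t : RootedPair m (Fin (m * n))) :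
    (ofRootedPair t).blackVertices = n := by
  -- Used only to know that there are `m * n` white half-edges.
  obtain ⟨ψ, -⟩ := exists_congr_of_equiv (ofRootedPair t) (Setoid.refl (ofRootedPair t))
  have h := (ofRootedPair t).card_whiteHalfEdge
  rw [Nat.card_congr ψ, Nat.card_fin] at h
  exact (Nat.eq_of_mul_eq_mul_left hm h).symm

/-- The rooted map of a rooted pair of permutations. -/
def rootedMapOfPair {m : ℕ} (hm : 0 < m) (n : ℕ) (t : RootedPair m (Fin (m * n))) :
    {M : RootedMap m // M.blackVertices = n} :=
  ⟨Quotient.mk _ (ofRootedPair t), blackVertices_ofRootedPair hm t⟩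

/-- The pairs encoding a given map correspond to the labellings of its `m * n` edges, without
repetition by rigidity. -/
theorem card_fiber_rootedMapOfPair {m : ℕ} (hm : 0 < m) (n : ℕ)
    (M : {M : RootedMap m // M.blackVertices = n}) :
    Nat.card {t // rootedMapOfPair hm n t = M} = (m * n).factorial := by
  obtain ⟨M, hM⟩ := M
  obtain ⟨M, rfl⟩ := Quotient.exists_rep M
  have h1 : Nat.card {t // rootedMapOfPair hm n t = ⟨Quotient.mk _ M, hM⟩} =
      Nat.card (M.WhiteHalfEdge ≃ Fin (m * n)) := by
    symm
    refine Nat.card_eq_of_bijective (fun ψ => ⟨RootedPair.congr ψ M.whitePair,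
      Subtype.ext (Quotient.sound (ofRootedPair_congr_equiv M ψ))⟩) ⟨?_, ?_⟩
    · intro ψ ψ' h
      exact congr_whitePair_injective M (congrArg Subtype.val h)
    · rintro ⟨t, ht⟩
      obtain ⟨ψ, hψ⟩ := exists_congr_of_equiv M (t := t) (Quotient.exact (congrArg Subtype.val ht))
      exact ⟨ψ, Subtype.ext hψ⟩
  have h2 : Nat.card M.WhiteHalfEdge = m * n := by
    rw [card_whiteHalfEdge]
    exact congrArg _ hM
  have e := Finite.equivFinOfCardEq h2
  rw [h1, Nat.card_congr (Equiv.equivCongr e (Equiv.refl _)), Nat.card_eq_fintype_card,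
    Fintype.card_perm, Fintype.card_fin]

theorem finite_rootedMap {m : ℕ} (hm : 0 < m) (n : ℕ) :
    Finite {M : RootedMap m // M.blackVertices = n} := by
  refine Finite.of_surjective (rootedMapOfPair hm n) fun M => ?_
  have h := card_fiber_rootedMapOfPair hm n M
  have h2 : Nat.card {t // rootedMapOfPair hm n t = M} ≠ 0 := by
    rw [h]; exact Nat.factorial_ne_zero _
  obtain ⟨t, ht⟩ := (Nat.card_ne_zero.mp h2).1
  exact ⟨t, ht⟩

theorem card_rootedPair {m : ℕ} (hm : 0 < m) (n : ℕ) :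
    Nat.card (RootedPair m (Fin (m * n))) =
      Nat.card {M : RootedMap m // M.blackVertices = n} * (m * n).factorial := by
  have := finite_rootedMap hm n
  have : Fintype {M : RootedMap m // M.blackVertices = n} := Fintype.ofFinite _
  rw [← Nat.card_congr (Equiv.sigmaFiberEquiv (rootedMapOfPair hm n)), Nat.card_sigma,
    Finset.sum_congr rfl fun M _ => card_fiber_rootedMapOfPair hm n M, Finset.sum_const,
    Finset.card_univ, ← Nat.card_eq_fintype_card, smul_eq_mul]

end BlossomMaps

namespace BlossomMaps

/-! ## Enumeration of rooted maps -/

/-- The number of rooted `m`-regular bipartite maps with `n` black vertices. -/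
noncomputable def mapCount (m n : ℕ) : ℕ := Nat.card {M : RootedMap m // M.blackVertices = n}

theorem coeff_allMaps {m : ℕ} (hm : 2 ≤ m) (n : ℕ) :
    PowerSeries.coeff n (allMaps m) =
      (Nat.card (RegularPerm m (Fin (m * n))) : ℚ) ^ 2 / (m * n).factorial := by
  have h1 := card_regularPerm hm n
  have hm0 : (m : ℚ) ≠ 0 := by positivity
  have h2 : (n.factorial : ℚ) ≠ 0 := by positivity
  have h3 : ((m * n).factorial : ℚ) ≠ 0 := by positivity
  have h4 : (Nat.card (RegularPerm m (Fin (m * n))) : ℚ) * (m ^ n * n.factorial) =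
      (m * n).factorial := by exact_mod_cast h1
  rw [allMaps, PowerSeries.coeff_mk, div_eq_div_iff (by positivity) h3, mul_comm 2 n, pow_mul]
  rw [← h4]
  ring

theorem card_rootedPair_of_not_dvd {m s : ℕ} (h : ¬ m ∣ s) : Nat.card (RootedPair m (Fin s)) = 0 := by
  have : IsEmpty (RootedPair m (Fin s)) :=
    ⟨fun t => h (by simpa using dvd_card_of_regularPerm t.1.1)⟩
  exact Nat.card_of_isEmpty

theorem mul_card_regularPerm_sq {m : ℕ} (hm : 0 < m) (n : ℕ) :
    m * n * Nat.card (RegularPerm m (Fin (m * n))) ^ 2 = ∑ a ∈ Finset.range (n + 1),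
      (m * n).choose (m * a) * (mapCount m a * (m * a).factorial *
        Nat.card (RegularPerm m (Fin (m * (n - a)))) ^ 2) := by
  rw [card_regularPerm_sq]
  symm
  refine Finset.sum_of_injOn (fun a => m * a) ?_ ?_ ?_ ?_
  · intro a _ b _ h
    exact Nat.eq_of_mul_eq_mul_left hm h
  · intro a ha
    rw [Finset.coe_range, Set.mem_Iio] at ha ⊢
    exact Nat.lt_succ_of_le (Nat.mul_le_mul_left m (Nat.le_of_lt_succ ha))
  · intro s hs hne
    rw [card_rootedPair_of_not_dvd, zero_mul, mul_zero]
    rintro ⟨a, rfl⟩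
    rw [Finset.mem_range] at hs
    refine hne ⟨a, ?_, rfl⟩
    rw [Finset.coe_range, Set.mem_Iio]
    exact Nat.lt_succ_of_le (Nat.le_of_mul_le_mul_left (Nat.le_of_lt_succ hs) hm)
  · intro a _
    rw [card_rootedPair hm, Nat.mul_sub]
    rfl

/-- This is `R Z = m g Z'`: dividing the count by components by `(m n)!` turns the binomial
convolution into a product of series. -/
theorem mapCount_mul_allMaps {m : ℕ} (hm : 2 ≤ m) :
    PowerSeries.mk (fun n => (mapCount m n : ℚ)) * allMaps m =
      PowerSeries.mk fun n => ((m : ℚ) * n) * PowerSeries.coeff n (allMaps m) := by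
  ext n
  rw [PowerSeries.coeff_mul, PowerSeries.coeff_mk, Finset.Nat.sum_antidiagonal_eq_sum_range_succ_mk,
    coeff_allMaps hm, ← mul_div_assoc]
  have h := congrArg (Nat.cast : ℕ → ℚ) (mul_card_regularPerm_sq (m := m) (by omega) n)
  push_cast at h
  rw [h, Finset.sum_div]
  refine Finset.sum_congr rfl fun a ha => ?_
  have ha' : m * a ≤ m * n :=
    Nat.mul_le_mul_left m (Nat.le_of_lt_succ (Finset.mem_range.mp ha))
  rw [PowerSeries.coeff_mk, coeff_allMaps hm, Nat.cast_choose ℚ ha', ← Nat.mul_sub]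
  have h1 : ((m * n).factorial : ℚ) ≠ 0 := by positivity
  have h2 : ((m * a).factorial : ℚ) ≠ 0 := by positivity
  have h3 : ((m * (n - a)).factorial : ℚ) ≠ 0 := by positivity
  field_simp

theorem series_one (k : ℕ) : WhiteTree.series k 1 = 1 + WhiteTree.blackSeries k 1 := by
  rw [(WhiteTree.solvesSystem_series k).r_eq 1 le_rfl, Finset.sum_range_succ',
    Finset.sum_eq_zero, zero_add, Nat.cast_zero, sub_zero, Int.cast_one]
  intro a _
  exact (WhiteTree.solvesSystem_series k).q_nonpos _ (by push_cast; omega)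

/-- The orthogonal polynomials and the decomposition into components give the same product with `Z`,
which is nonzero (constant term `1`) and can be cancelled. -/
theorem coeff_blackSeries_one {k : ℕ} (n : ℕ) :
    PowerSeries.coeff n (WhiteTree.blackSeries k 1) = mapCount (k + 2) n := by
  set Z := allMaps (k + 2)
  have h := (WhiteTree.solvesSystem_series k).map (PowerSeries.map (Int.castRingHom ℚ))
  rw [PowerSeries.map_X] at h
  have h1 := h.mul_allMaps (Nat.succ_pos k)
  simp only [series_one, map_add, map_one] at h1
  have h2 : PowerSeries.map (Int.castRingHom ℚ) (WhiteTree.blackSeries k 1) * Z =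
      PowerSeries.mk (fun n => (mapCount (k + 2) n : ℚ)) * Z := by
    rw [mapCount_mul_allMaps (by omega)]
    rw [add_mul, one_mul] at h1
    rw [← sub_eq_iff_eq_add'.mpr h1.symm]
    ext n
    rw [map_sub, PowerSeries.coeff_mk, PowerSeries.coeff_mk]
    ring
  have hZ : Z ≠ 0 := by
    intro h0
    have := congrArg (PowerSeries.coeff 0) h0
    simp [Z, allMaps] at this
  have h3 := congrArg (PowerSeries.coeff n) (mul_right_cancel₀ hZ h2)
  rw [PowerSeries.coeff_map, PowerSeries.coeff_mk, eq_intCast] at h3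
  exact_mod_cast h3

/-! ## The trivial map -/

/-- The maps with `n` black vertices, the trivial one included. -/
def rootedMapOrTrivialEquiv (m n : ℕ) :
    {M : RootedMapOrTrivial m // M.blackVertices = n} ≃
      {M : RootedMap m // M.blackVertices = n} ⊕ {_u : PUnit.{1} // 0 = n} :=
  ((Equiv.optionEquivSumPUnit (RootedMap m)).subtypeEquiv
    (q := Sum.elim (fun M => M.blackVertices = n) fun _ => 0 = n) fun M => by
      cases M <;> rfl).trans Equiv.subtypeSum

theorem finite_rootedMapOrTrivial {m : ℕ} (hm : 0 < m) (n : ℕ) :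
    Finite {M : RootedMapOrTrivial m // M.blackVertices = n} :=
  have := finite_rootedMap hm n
  Finite.of_equiv _ (rootedMapOrTrivialEquiv m n).symm

theorem card_rootedMapOrTrivial (k n : ℕ) :
    PowerSeries.coeff n (WhiteTree.series k 1) =
      Nat.card {M : RootedMapOrTrivial (k + 2) // M.blackVertices = n} := by
  have := finite_rootedMap (Nat.succ_pos (k + 1)) n
  rw [Nat.card_congr (rootedMapOrTrivialEquiv (k + 2) n), Nat.card_sum, series_one, map_add,
    coeff_blackSeries_one, PowerSeries.coeff_one, Nat.cast_add, add_comm]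
  congr 1
  split_ifs with h
  · subst h; simp
  · have : IsEmpty {_u : PUnit.{1} // 0 = n} := ⟨fun u => h u.2.symm⟩
    simp

theorem exists_equiv_of_card_fiber {α β : Type*} (f : α → ℕ) (g : β → ℕ)
    (hf : ∀ n, Finite {a // f a = n}) (hg : ∀ n, Finite {b // g b = n})
    (h : ∀ n, Nat.card {a // f a = n} = Nat.card {b // g b = n}) :
    ∃ e : α ≃ β, ∀ a, g (e a) = f a := by
  have e : ∀ n, {a // f a = n} ≃ {b // g b = n} := fun n =>
    have := hf n
    have := hg n
    (Finite.card_eq.mp (h n)).some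
  refine ⟨((Equiv.sigmaFiberEquiv f).symm.trans (Equiv.sigmaCongrRight e)).trans
    (Equiv.sigmaFiberEquiv g), fun a => ?_⟩
  exact (e (f a) ⟨a, rfl⟩).2

/-- Matched trees with `n` black nodes are as many as enriched trees. -/
noncomputable def matchedOfSizeEquiv (m n : ℕ) :
    {T : MatchedTree m // T.tree.blackNodes = n} ≃ {T : EnrichedTree m // T.tree.blackNodes = n} :=
  ((enrichedEquivMatched m).subtypeEquiv fun T => by rw [tree_enrichedEquivMatched]).symm

end BlossomMaps

/-! ### Assembly of the bijections and the counts. -/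

theorem mainTheorem2 (m : ℕ) (hm : 3 ≤ m) :
    (∃ e₁ : BlossomMaps.EnrichedTree m ≃ BlossomMaps.MatchedTree m,
      ∃ e₂ : BlossomMaps.MatchedTree m ≃ BlossomMaps.RootedMapOrTrivial m,
        (∀ T, (e₁ T).tree = T.tree) ∧
        (∀ T, (e₁ T).tree.blackNodes = T.tree.blackNodes) ∧
        (∀ T, (e₂ T).blackVertices = T.tree.blackNodes)) ∧
    (∃ r q : ℤ → PowerSeries ℤ,
      BlossomMaps.IsSolution m r q ∧
      (∀ r' q', BlossomMaps.IsSolution m r' q' → ∀ i ≥ 1, r' i = r i ∧ q' i = q i) ∧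
      r 1 = 1 + q 1 ∧
      ∀ n : ℕ,
        (Finite {T : BlossomMaps.EnrichedTree m // T.tree.blackNodes = n} ∧
          PowerSeries.coeff n (r 1) =
            Nat.card {T : BlossomMaps.EnrichedTree m // T.tree.blackNodes = n}) ∧
        (Finite {T : BlossomMaps.MatchedTree m // T.tree.blackNodes = n} ∧
          PowerSeries.coeff n (r 1) =
            Nat.card {T : BlossomMaps.MatchedTree m // T.tree.blackNodes = n}) ∧
        (Finite {M : BlossomMaps.RootedMapOrTrivial m // M.blackVertices = n} ∧
          PowerSeries.coeff n (r 1) =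
            Nat.card {M : BlossomMaps.RootedMapOrTrivial m // M.blackVertices = n}) ∧
        (Finite {M : BlossomMaps.RootedMap m // M.blackVertices = n} ∧
          PowerSeries.coeff n (q 1) =
            Nat.card {M : BlossomMaps.RootedMap m // M.blackVertices = n})) := by
  open BlossomMaps in
  obtain ⟨k, rfl⟩ : ∃ k, m = k + 2 := ⟨m - 2, by omega⟩
  have hpos : 0 < k + 2 := Nat.succ_pos _
  have hfin₁ := finite_enrichedTree k
  have hfin₂ : ∀ n, Finite {T : MatchedTree (k + 2) // T.tree.blackNodes = n} := fun n =>
    Finite.of_equiv _ (matchedOfSizeEquiv (k + 2) n).symm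
  have hcard₂ : ∀ n, PowerSeries.coeff n (WhiteTree.series k 1) =
      Nat.card {T : MatchedTree (k + 2) // T.tree.blackNodes = n} := fun n => by
    rw [Nat.card_congr (matchedOfSizeEquiv (k + 2) n), card_enrichedTree]
  have hfin₃ := finite_rootedMapOrTrivial hpos
  -- This bijection is chosen degree by degree from the equality of finite cardinalities.
  obtain ⟨e₂, he₂⟩ := exists_equiv_of_card_fiber
    (fun T : MatchedTree (k + 2) => T.tree.blackNodes)
    (fun M : RootedMapOrTrivial (k + 2) => M.blackVertices) hfin₂ hfin₃ fun n => by
      have := (hcard₂ n).symm.trans (card_rootedMapOrTrivial k n)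
      exact_mod_cast this
  refine ⟨⟨enrichedEquivMatched (k + 2), e₂, tree_enrichedEquivMatched, fun T => by
    rw [tree_enrichedEquivMatched], he₂⟩, WhiteTree.series k, WhiteTree.blackSeries k,
    isSolution_iff.mpr (WhiteTree.solvesSystem_series k), fun r' q' h i hi =>
      (isSolution_iff.mp h).unique dvd_rfl (WhiteTree.solvesSystem_series k) i hi,
    series_one k, fun n => ⟨⟨hfin₁ n, card_enrichedTree k n⟩, ⟨hfin₂ n, hcard₂ n⟩,
      ⟨hfin₃ n, card_rootedMapOrTrivial k n⟩, finite_rootedMap hpos n, coeff_blackSeries_one n⟩⟩
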